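/- For elements $g,h$ of a group write $g^h=h^{-1}gh$ and $[g,h]=g^{-1}h^{-1}gh$, and for a subset $S$ of a group write $S^2=\{st \mid s,t\in S\}$. Let $$G=\langle a,b \mid a^{b^2}=aa^b,\ [a,a^b]=1\rangle .$$ Then $G\cong \mathbb{Z}^2\rtimes\mathbb{Z}$, where $a\mapsto (1,0)\in\mathbb{Z}^2$, $b\mapsto$ the generator $t$ of $\mathbb{Z}$, and $t$ acts on $\mathbb{Z}^2$ by $(u,v)^t=(u,v)\begin{pmatrix}0&1\\1&1\end{pmatrix}=(v,u+v)$. Moreover: (i) $G$ is orderable, i.e. there is a total order $\leq$ on $G$ such that $g\leq h$ implies $xgy\leq xhy$ for all $g,h,x,y\in G$. (ii) If $S$ is a finite subset of $G$ with $\langle S\rangle=G$ and $|S^2|=3|S|-2$, then $|S|\leq 4$. (iii) Let $\leq$ be any total order on $G$ as in (i), and let $S$ be as in (ii) with $|S|=4$. Then there are $x,c\in G$ with $c>1$ and $c^{x^2}=cc^x=c^xc$ such that either $S=\{x,\,xc,\,xc^x,\,xc^{x^2}\}$ or $S=\{x^{-1},\,x^{-1}c,\,x^{-1}c^x,\,x^{-1}c^{x^2}\}$.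 -/

import Mathlib

open scoped Pointwise

/-- Right conjugation `g ^ h = h⁻¹ g h`. -/
def rconj {G : Type*} [Group G] (g h : G) : G := h⁻¹ * g * h

/-- The defining relators, in the free group on `a = of 0` and `b = of 1`:
`a ^ (b ^ 2) = a (a ^ b)` and `a (a ^ b) = (a ^ b) a`. -/
def fibRels : Set (FreeGroup (Fin 2)) :=
  let a : FreeGroup (Fin 2) := FreeGroup.of 0
  let b : FreeGroup (Fin 2) := FreeGroup.of 1
  {rconj a (b ^ 2) * (a * rconj a b)⁻¹, (a * rconj a b) * (rconj a b * a)⁻¹}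

/-- The group `⟨a, b | a ^ (b ^ 2) = a (a ^ b), a (a ^ b) = (a ^ b) a⟩`. -/
abbrev FibGroup : Type := PresentedGroup fibRels

/-- The total order `o` is compatible with the multiplication on both sides. -/
def IsGroupOrder {G : Type*} [Group G] (o : LinearOrder G) : Prop :=
  ∀ a b x y : G, o.le a b → o.le (x * a * y) (x * b * y)

/-- A group is orderable if it admits a two-sided invariant total order. -/
def IsOrderableGroup (G : Type*) [Group G] : Prop :=
  ∃ o : LinearOrder G, IsGroupOrder o

/-- The automorphism `(u, v) ↦ (u, v) B = (v, u + v)` of `ℤ²` given by the Fibonacci matrix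
`B = (0 1; 1 1)` acting on row vectors. -/
def fibAut : (ℤ × ℤ) ≃+ (ℤ × ℤ) where
  toFun p := (p.2, p.1 + p.2)
  invFun p := (p.2 - p.1, p.1)
  left_inv p := by ext <;> simp
  right_inv p := by ext <;> simp
  map_add' p q := by ext <;> simp <;> ring

/-- The action of `ℤ` on `ℤ²` (both written multiplicatively) for which *right* conjugation by
the generator of `ℤ` in the semidirect product is `fibAut`; in `SemidirectProduct` the action is
left conjugation, which explains the inverse. -/
def fibAction : Multiplicative ℤ →* MulAut (Multiplicative (ℤ × ℤ)) :=
  zpowersHom (MulAut (Multiplicative (ℤ × ℤ)))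
    (AddEquiv.toMultiplicative fibAut : MulAut (Multiplicative (ℤ × ℤ)))⁻¹

/-! The eigenvalue `φ` of the Fibonacci matrix embeds ℤ² in ℝ by (u, v) ↦ u + vφ, and with it the
group in `FibAff` = ℤ ⋉ ℝ, where ℤ acts by powers of `φ`; irrationality of `φ` gives injectivity.
Ordering `FibAff` lexicographically, level first, makes it a bi-ordered group, which proves
orderability. Commuting is moreover transitive through nontrivial elements, and all counting takes
place in `FibAff`.

In such a group, deleting an extreme element of a noncommutative finite set destroys at least three
products, so |S²| ≥ 3|S| - 2 (`three_mul_card_le_card_mul_self_add_two`). If |S| ≥ 4 and S meets two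
levels, one more product can be gained (`three_mul_card_le_card_mul_self_add_one`); the base case
|S| = 4 rests on comparing products level by level. Hence an extremal generating set with at least
four elements lies in a single level, and that level is ±1, since the level map sends the group onto
ℤ.

In level 1 the product of elements with values p and q has value φp + q. Three elements with at most
seven products have one of two gap ratios; four with at most ten have the values r, r + c, r + φc, r
+ (φ+1)c (`exists_val_eq_of_card_le_ten`). Two such patterns cannot overlap, so five elements have
at least fourteen products. The four-element pattern is `fibQuad`; reading it from the other end
inverts c, so c can be made positive for every invariant order. -/

/-- Some two elements of the set do not commute. -/
def HasNoncommPair {G : Type*} [Group G] (S : Finset G) : Prop :=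
  ∃ x ∈ S, ∃ y ∈ S, ¬ Commute x y

/-- Commuting is transitive through nontrivial elements. -/
def IsCommTransitive (G : Type*) [Group G] : Prop :=
  ∀ x y z : G, y ≠ 1 → Commute x y → Commute y z → Commute x z

/-! ### Finite sets in linear orders -/

section Orders

theorem Finset.exists_insert_max {α : Type*} [LinearOrder α] {S : Finset α} {n : ℕ}
    (h : S.card = n + 1) :
    ∃ x T, S = insert x T ∧ x ∉ T ∧ T.card = n ∧ ∀ y ∈ T, y < x := by
  have hne : S.Nonempty := Finset.card_pos.mp (by omega)
  refine ⟨S.max' hne, S.erase (S.max' hne), (Finset.insert_erase (S.max'_mem hne)).symm,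
    Finset.notMem_erase _ _, ?_, fun y hy => ?_⟩
  · rw [Finset.card_erase_of_mem (S.max'_mem hne), h]; rfl
  · exact S.lt_max'_of_mem_erase_max' hne hy

theorem Finset.exists_maximal_filter {α : Type*} [LinearOrder α] (T : Finset α) (p : α → Prop)
    (h : ∃ a ∈ T, p a) : ∃ a ∈ T, p a ∧ ∀ b ∈ T, p b → b ≤ a := by
  classical
  obtain ⟨a, ha, hpa⟩ := h
  obtain ⟨m, hm, hmax⟩ := (T.filter p).exists_max_image id ⟨a, by simp [ha, hpa]⟩
  simp only [Finset.mem_filter, id] at hm hmax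
  exact ⟨m, hm.1, hm.2, fun b hb hpb => hmax b ⟨hb, hpb⟩⟩

/-- A finite set contained in `A` and disjoint from `B ⊆ A` adds to the cardinality. -/
theorem Finset.card_add_le_of_new {α : Type*} [DecidableEq α] {A B C : Finset α} (hBA : B ⊆ A)
    (hC : ∀ c ∈ C, c ∈ A ∧ c ∉ B) : B.card + C.card ≤ A.card := by
  rw [← Finset.card_union_of_disjoint]
  · exact Finset.card_le_card (Finset.union_subset hBA fun c hc => (hC c hc).1)
  · exact Finset.disjoint_right.mpr fun c hc => (hC c hc).2

end Orders

/-! ### Noncommutative finite sets -/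

section NoncommPair

variable {G : Type*} [Group G]

theorem HasNoncommPair.mono {S T : Finset G} (h : HasNoncommPair S) (hST : S ⊆ T) :
    HasNoncommPair T := by
  obtain ⟨x, hx, y, hy, hxy⟩ := h
  exact ⟨x, hST hx, y, hST hy, hxy⟩

theorem HasNoncommPair.exists_of_ne_one (hG : IsCommTransitive G) {S : Finset G}
    (h : HasNoncommPair S) {x : G} (hx : x ≠ 1) : ∃ z ∈ S, ¬ Commute x z := by
  by_contra! hc
  obtain ⟨u, hu, v, hv, huv⟩ := h
  exact huv (hG u x v hx (hc u hu).symm (hc v hv))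

theorem HasNoncommPair.inv [DecidableEq G] {S : Finset G} (h : HasNoncommPair S) :
    HasNoncommPair S⁻¹ := by
  obtain ⟨u, hu, v, hv, huv⟩ := h
  refine ⟨u⁻¹, Finset.inv_mem_inv hu, v⁻¹, Finset.inv_mem_inv hv, fun hc => huv ?_⟩
  exact Commute.inv_inv_iff.mp hc

theorem card_inv_mul_inv [DecidableEq G] (S : Finset G) :
    (S⁻¹ * S⁻¹).card = (S * S).card := by
  rw [← mul_inv_rev, Finset.card_inv]

theorem Commute.mul_left_cancel_of {x y z : G} (h : Commute x (y * z)) (hy : Commute x y) :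
    Commute x z := by
  have := hy.inv_right.mul_right h
  simpa using this

theorem Commute.mul_right_cancel_of {x y z : G} (h : Commute x (y * z)) (hz : Commute x z) :
    Commute x y := by
  have := h.mul_right hz.inv_right
  simpa using this

end NoncommPair

theorem mul_self_ne_one_of_ne_one {G : Type*} [Group G] [LinearOrder G] [MulLeftMono G] {x : G}
    (hx : x ≠ 1) : x * x ≠ 1 := by
  rcases lt_or_gt_of_ne hx with h | h
  · exact (mul_lt_one' h h).ne
  · exact (one_lt_mul'' h h).ne'

/-! ### Product sets in ordered groups with transitive commuting -/

section OrderedGroup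

variable {G : Type*} [Group G] [LinearOrder G] [MulLeftMono G] [MulRightMono G]

/-- Removing the largest element of a noncommutative set loses at least three products. -/
theorem card_mul_self_erase_max_add_three_le (hG : IsCommTransitive G) {T : Finset G} {x : G}
    (hS : HasNoncommPair (insert x T)) (hx : ∀ y ∈ T, y < x) :
    (T * T).card + 3 ≤ (insert x T * insert x T).card := by
  have hsub : T * T ⊆ insert x T * insert x T :=
    Finset.mul_subset_mul (Finset.subset_insert _ _) (Finset.subset_insert _ _)
  have key : ∀ a b c : G, a ≠ b → a ≠ c → b ≠ c →
      (∀ d, d = a ∨ d = b ∨ d = c → d ∈ insert x T * insert x T ∧ d ∉ T * T) →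
      (T * T).card + 3 ≤ (insert x T * insert x T).card := by
    intro a b c hab hac hbc h
    have h3 : ({a, b, c} : Finset G).card = 3 := by simp [hab, hac, hbc]
    rw [← h3]
    exact Finset.card_add_le_of_new hsub fun d hd => h d (by simpa using hd)
  -- For `x = 1` all of `T` is negative. The new products are 1, the maximum `u` of `T`, and the
  -- largest `w` not commuting with `u`: factors of `w` in `T` would exceed `w`, hence commute with
  -- `u`.
  by_cases hx1 : x = 1
  · subst hx1
    have hT : HasNoncommPair T := by
      obtain ⟨u, hu, v, hv, huv⟩ := hS
      have hu1 : u ≠ 1 := by rintro rfl; exact huv (Commute.one_left v)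
      have hv1 : v ≠ 1 := by rintro rfl; exact huv (Commute.one_right u)
      exact ⟨u, Finset.mem_of_mem_insert_of_ne hu hu1, v,
        Finset.mem_of_mem_insert_of_ne hv hv1, huv⟩
    obtain ⟨u, hu, -, humax⟩ := T.exists_maximal_filter (fun _ => True)
      (by obtain ⟨u, hu, -⟩ := hT; exact ⟨u, hu, trivial⟩)
    obtain ⟨w, hw, hwu, hwmax⟩ := T.exists_maximal_filter (fun w => ¬ Commute u w)
      (hT.exists_of_ne_one hG (hx u hu).ne)
    have hne : u ≠ w := by rintro rfl; exact hwu (Commute.refl _)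
    refine key 1 u w (hx u hu).ne' (hx w hw).ne' hne ?_
    rintro d (rfl | rfl | rfl)
    · refine ⟨Finset.mem_mul.mpr ⟨1, by simp, 1, by simp, by simp⟩, fun h => ?_⟩
      obtain ⟨p, hp, q, hq, hpq⟩ := Finset.mem_mul.mp h
      exact (mul_lt_one' (hx p hp) (hx q hq)).ne hpq
    · refine ⟨Finset.mem_mul.mpr ⟨1, by simp, d, by simp [hu], by simp⟩, fun h => ?_⟩
      obtain ⟨p, hp, q, hq, hpq⟩ := Finset.mem_mul.mp h
      have : p * q < d * 1 := mul_lt_mul_of_le_of_lt (humax p hp trivial) (hx q hq)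
      rw [mul_one, hpq] at this
      exact this.false
    · refine ⟨Finset.mem_mul.mpr ⟨1, by simp, d, by simp [hw], by simp⟩, fun h => ?_⟩
      obtain ⟨p, hp, q, hq, hpq⟩ := Finset.mem_mul.mp h
      have h1 : d < p := by
        rw [← hpq]; exact mul_lt_of_lt_one_right' p (hx q hq)
      have h2 : d < q := by
        rw [← hpq]; exact mul_lt_of_lt_one_left' q (hx p hp)
      have hpc : Commute u p := by
        by_contra hc; exact (hwmax p hp hc).not_gt h1
      have hqc : Commute u q := by
        by_contra hc; exact (hwmax q hq hc).not_gt h2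
      exact hwu (hpq ▸ hpc.mul_right hqc)
  · have hxz : ∃ z ∈ T, ¬ Commute x z := by
      obtain ⟨z, hz, hxz⟩ := hS.exists_of_ne_one hG hx1
      have hzx : z ≠ x := by rintro rfl; exact hxz (Commute.refl _)
      exact ⟨z, Finset.mem_of_mem_insert_of_ne hz hzx, hxz⟩
    obtain ⟨z, hz, hzc, hzmax⟩ := T.exists_maximal_filter (fun w => ¬ Commute x w) hxz
    obtain ⟨y, hy, -, hymax⟩ := T.exists_maximal_filter (fun _ => True) ⟨z, hz, trivial⟩
    have hxx : x * x ∈ insert x T * insert x T ∧ x * x ∉ T * T := by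
      refine ⟨Finset.mul_mem_mul (by simp) (by simp), fun h => ?_⟩
      obtain ⟨p, hp, q, hq, hpq⟩ := Finset.mem_mul.mp h
      exact (mul_lt_mul_of_lt_of_lt (hx p hp) (hx q hq)).ne hpq
    have hxy : x * y ∈ insert x T * insert x T ∧ x * y ∉ T * T := by
      refine ⟨Finset.mul_mem_mul (by simp) (by simp [hy]), fun h => ?_⟩
      obtain ⟨p, hp, q, hq, hpq⟩ := Finset.mem_mul.mp h
      exact (mul_lt_mul_of_lt_of_le (hx p hp) (hymax q hq trivial)).ne hpq
    have hxy' : x * x ≠ x * y := fun h => (hx y hy).ne' (mul_left_cancel h)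
    -- If `x` and `y` do not commute, `y * x` is the third product. Otherwise it is the larger of `x
    -- * z` and `z * x`: factors of it in `T` would both exceed `z`, hence commute with `x`, while
    -- the product does not.
    by_cases hyc : Commute x y
    · have hnotC : ∀ d, d = x * z ∨ d = z * x → ¬ Commute x d := by
        rintro d (rfl | rfl) hc
        · exact hzc (hc.mul_left_cancel_of (Commute.refl x))
        · exact hzc (hc.mul_right_cancel_of (Commute.refl x))
      have main : ∀ d, (d = x * z ∨ d = z * x) → x * z ≤ d → z * x ≤ d →
          d ∈ insert x T * insert x T ∧ d ∉ T * T := by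
        intro d hd h1 h2
        refine ⟨?_, fun h => ?_⟩
        · rcases hd with rfl | rfl
          · exact Finset.mul_mem_mul (by simp) (by simp [hz])
          · exact Finset.mul_mem_mul (by simp [hz]) (by simp)
        obtain ⟨p, hp, q, hq, hpq⟩ := Finset.mem_mul.mp h
        have hq' : z < q := by
          by_contra! hle
          exact ((mul_lt_mul_of_lt_of_le (hx p hp) hle).trans_le h1).ne hpq
        have hp' : z < p := by
          by_contra! hle
          exact ((mul_lt_mul_of_le_of_lt hle (hx q hq)).trans_le h2).ne hpq
        have hpc : Commute x p := by
          by_contra hc; exact (hzmax p hp hc).not_gt hp'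
        have hqc : Commute x q := by
          by_contra hc; exact (hzmax q hq hc).not_gt hq'
        exact hnotC d hd (hpq ▸ hpc.mul_right hqc)
      have fin : ∀ d, (d = x * z ∨ d = z * x) → x * z ≤ d → z * x ≤ d →
          (T * T).card + 3 ≤ (insert x T * insert x T).card := by
        intro d hd h1 h2
        refine key (x * x) (x * y) d hxy' ?_ ?_ ?_
        · rintro rfl; exact hnotC _ hd ((Commute.refl x).mul_right (Commute.refl x))
        · rintro rfl; exact hnotC _ hd ((Commute.refl x).mul_right hyc)
        · rintro e (rfl | rfl | rfl)
          exacts [hxx, hxy, main _ hd h1 h2]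
      rcases le_total (x * z) (z * x) with h | h
      · exact fin _ (Or.inr rfl) h le_rfl
      · exact fin _ (Or.inl rfl) le_rfl h
    · refine key (x * x) (x * y) (y * x) hxy' (fun h => (hx y hy).ne' (mul_right_cancel h)) hyc ?_
      rintro e (rfl | rfl | rfl)
      · exact hxx
      · exact hxy
      · refine ⟨Finset.mul_mem_mul (by simp [hy]) (by simp), fun h => ?_⟩
        obtain ⟨p, hp, q, hq, hpq⟩ := Finset.mem_mul.mp h
        exact (mul_lt_mul_of_le_of_lt (hymax p hp trivial) (hx q hq)).ne hpq

/-- Removing the smallest element of a noncommutative set loses at least three products. -/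
theorem card_mul_self_erase_min_add_three_le (hG : IsCommTransitive G) {T : Finset G} {x : G}
    (hS : HasNoncommPair (insert x T)) (hx : ∀ y ∈ T, x < y) :
    (T * T).card + 3 ≤ (insert x T * insert x T).card := by
  have h := card_mul_self_erase_max_add_three_le hG (T := T⁻¹) (x := x⁻¹)
    (by simpa [Finset.inv_insert] using hS.inv)
    (fun y hy => lt_inv'.mp (hx _ (Finset.mem_inv'.mp hy)))
  rwa [← Finset.inv_insert, card_inv_mul_inv, card_inv_mul_inv] at h

/-- Left and right translates by an element not commuting with all of `T` differ. -/
theorem card_add_one_le_card_translates {T : Finset G} {x : G} (h : ∃ t ∈ T, ¬ Commute x t) :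
    T.card + 1 ≤ ({x} * T ∪ T * {x}).card := by
  have hT : ({x} * T).card = T.card := by
    rw [Finset.singleton_mul]; exact Finset.card_image_of_injective _ (mul_right_injective x)
  have hT' : (T * {x}).card = T.card := by
    rw [Finset.mul_singleton]; exact Finset.card_image_of_injective _ (mul_left_injective x)
  by_contra! hlt
  have h1 : {x} * T = {x} * T ∪ T * {x} :=
    Finset.eq_of_subset_of_card_le Finset.subset_union_left (by omega)
  have h2 : T * {x} = {x} * T ∪ T * {x} :=
    Finset.eq_of_subset_of_card_le Finset.subset_union_right (by omega)
  have heq : {x} * T = T * {x} := h1.trans h2.symm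
  -- If both translates coincide, the larger of `x * t` and `t * x` rewrites with some `s > t` in
  -- place of `t`; such an `s` commutes with `x`, and cancelling gives `s = t`.
  obtain ⟨t, ht, hc, hmax⟩ := T.exists_maximal_filter (fun t => ¬ Commute x t) h
  have hcomm : ∀ s ∈ T, t < s → Commute x s := fun s hs hts => by
    by_contra hcs; exact (hmax s hs hcs).not_gt hts
  rcases lt_or_gt_of_ne (show x * t ≠ t * x from hc) with hlt' | hlt'
  · have hm : t * x ∈ {x} * T := heq ▸ Finset.mul_mem_mul ht (by simp)
    obtain ⟨p, hp, s, hs, hps⟩ := Finset.mem_mul.mp hm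
    obtain rfl := Finset.mem_singleton.mp hp
    rw [← hps] at hlt'
    have hts : t < s := lt_of_mul_lt_mul_left' hlt'
    have := hcomm s hs hts
    rw [this.eq] at hps
    exact hts.ne' (mul_right_cancel hps)
  · have hm : x * t ∈ T * {x} := heq ▸ Finset.mul_mem_mul (by simp) ht
    obtain ⟨s, hs, p, hp, hps⟩ := Finset.mem_mul.mp hm
    obtain rfl := Finset.mem_singleton.mp hp
    rw [← hps] at hlt'
    have hts : t < s := lt_of_mul_lt_mul_right' hlt'
    have := hcomm s hs hts
    rw [← this.eq] at hps
    exact hts.ne' (mul_left_cancel hps)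

/-- The products of a commutative set extended by one element not commuting with it. -/
theorem card_mul_self_insert_ge (hG : IsCommTransitive G) {T : Finset G} {x : G}
    (hT : ¬ HasNoncommPair T) (h : ∃ t ∈ T, ¬ Commute x t) :
    (T * T).card + ({x} * T ∪ T * {x}).card + 1 ≤ (insert x T * insert x T).card := by
  have hT' : ∀ u ∈ T, ∀ v ∈ T, Commute u v := by
    intro u hu v hv; by_contra hc; exact hT ⟨u, hu, v, hv, hc⟩
  obtain ⟨t, ht, hxt⟩ := h
  have hx1 : x ≠ 1 := by rintro rfl; exact hxt (Commute.one_left t)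
  have hxT : x ∉ T := fun hx => hxt (hT' x hx t ht)
  have hTt : ∀ d ∈ T * T, Commute t d := by
    intro d hd
    obtain ⟨p, hp, q, hq, rfl⟩ := Finset.mem_mul.mp hd
    exact (hT' t ht p hp).mul_right (hT' t ht q hq)
  have hxU : x * x ∉ {x} * T ∪ T * {x} := by
    intro hm
    rcases Finset.mem_union.mp hm with hm | hm
    · obtain ⟨p, hp, s, hs, hps⟩ := Finset.mem_mul.mp hm
      obtain rfl := Finset.mem_singleton.mp hp
      exact hxT (mul_left_cancel hps ▸ hs)
    · obtain ⟨s, hs, p, hp, hps⟩ := Finset.mem_mul.mp hm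
      obtain rfl := Finset.mem_singleton.mp hp
      exact hxT (mul_right_cancel hps ▸ hs)
  have hsub : T * T ⊆ insert x T * insert x T :=
    Finset.mul_subset_mul (Finset.subset_insert _ _) (Finset.subset_insert _ _)
  have := Finset.card_add_le_of_new (C := insert (x * x) ({x} * T ∪ T * {x})) hsub ?_
  · rwa [Finset.card_insert_of_notMem hxU, ← add_assoc] at this
  intro c hc
  rw [Finset.mem_insert, Finset.mem_union] at hc
  rcases hc with rfl | hc | hc
  · refine ⟨Finset.mul_mem_mul (by simp) (by simp), fun hm => ?_⟩
    exact hxt (hG x (x * x) t (mul_self_ne_one_of_ne_one hx1)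
      ((Commute.refl x).mul_right (Commute.refl x)) (hTt _ hm).symm)
  · obtain ⟨p, hp, s, hs, rfl⟩ := Finset.mem_mul.mp hc
    obtain rfl := Finset.mem_singleton.mp hp
    refine ⟨Finset.mul_mem_mul (by simp) (by simp [hs]), fun hm => ?_⟩
    exact hxt ((hTt _ hm).mul_right_cancel_of (hT' t ht s hs)).symm
  · obtain ⟨s, hs, p, hp, rfl⟩ := Finset.mem_mul.mp hc
    obtain rfl := Finset.mem_singleton.mp hp
    refine ⟨Finset.mul_mem_mul (by simp [hs]) (by simp), fun hm => ?_⟩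
    exact hxt ((hTt _ hm).mul_left_cancel_of (hT' t ht s hs)).symm

/-- A noncommutative finite set of an ordered group satisfies `3 |S| ≤ |S²| + 2`. -/
theorem three_mul_card_le_card_mul_self_add_two (hG : IsCommTransitive G) {S : Finset G}
    (hS : HasNoncommPair S) : 3 * S.card ≤ (S * S).card + 2 := by
  induction hn : S.card generalizing S with
  | zero =>
    omega
  | succ n ih =>
    obtain ⟨x, T, rfl, hxT, hTn, hx⟩ := Finset.exists_insert_max hn
    by_cases hT : HasNoncommPair T
    · have := card_mul_self_erase_max_add_three_le hG hS hx
      have := ih hT hTn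
      omega
    · have hxt : ∃ t ∈ T, ¬ Commute x t := by
        by_contra! hc
        obtain ⟨u, hu, v, hv, huv⟩ := hS
        rw [Finset.mem_insert] at hu hv
        rcases hu with rfl | hu <;> rcases hv with rfl | hv
        · exact huv (Commute.refl _)
        · exact huv (hc v hv)
        · exact huv (hc u hu).symm
        · exact hT ⟨u, hu, v, hv, huv⟩
      -- With `T` commutative the count is (2|T| - 1) + (|T| + 1) + 1 = 3|S| - 2.
      have h1 := card_mul_self_insert_ge hG hT hxt
      have h2 := card_add_one_le_card_translates hxt
      have hne : T.Nonempty := by obtain ⟨t, ht, -⟩ := hxt; exact ⟨t, ht⟩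
      have h3 := cauchy_davenport_mul_of_linearOrder_isCancelMul hne hne
      omega

end OrderedGroup

/-! ### Conjugation and the Fibonacci quadruples -/

section Conjugation

variable {G : Type*} [Group G]

theorem rconj_mul_left (g h x : G) : rconj (g * h) x = rconj g x * rconj h x := by
  simp only [rconj]; group

theorem rconj_inv_left (g x : G) : rconj g⁻¹ x = (rconj g x)⁻¹ := by
  simp only [rconj]; group

theorem rconj_mul_right (g x y : G) : rconj g (x * y) = rconj (rconj g x) y := by
  simp only [rconj]; group

theorem rconj_sq (g x : G) : rconj g (x ^ 2) = rconj (rconj g x) x := by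
  rw [sq, rconj_mul_right]

theorem rconj_zpow_left (g x : G) (k : ℤ) : rconj (g ^ k) x = rconj g x ^ k := by
  have := conj_zpow (i := k) (a := x⁻¹) (b := g)
  rw [inv_inv] at this
  exact this.symm

theorem rconj_eq_self_of_commute {g x : G} (h : Commute g x) : rconj g x = g := by
  rw [rconj, mul_assoc, h.eq, inv_mul_cancel_left]

theorem map_rconj {H : Type*} [Group H] (f : G →* H) (g x : G) :
    f (rconj g x) = rconj (f g) (f x) := by
  simp [rconj]

/-- The pair `(x, c)` satisfies the defining relations of `FibGroup`. -/
def IsFibPair (x c : G) : Prop :=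
  rconj c (x ^ 2) = c * rconj c x ∧ c * rconj c x = rconj c x * c

/-- The set `{x, x c, x c ^ x, x c ^ (x ^ 2)}`. -/
def fibQuad (x c : G) : Set G :=
  {x, x * c, x * rconj c x, x * rconj c (x ^ 2)}

/-- Reversing the order of the elements of `fibQuad x c` inverts `c`. -/
theorem IsFibPair.reverse {x c : G} (h : IsFibPair x c) :
    IsFibPair (x * rconj c (x ^ 2)) c⁻¹ ∧
      fibQuad (x * rconj c (x ^ 2)) c⁻¹ = fibQuad x c := by
  obtain ⟨h1, h2⟩ := h
  have hc1 : Commute (rconj c x) (rconj c (x ^ 2)) := by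
    rw [h1]; exact (show Commute (rconj c x) c from h2.symm).mul_right (Commute.refl _)
  have e1 : rconj c⁻¹ (x * rconj c (x ^ 2)) = (rconj c x)⁻¹ := by
    rw [rconj_inv_left, rconj_mul_right, rconj_eq_self_of_commute hc1]
  have e2 : rconj c⁻¹ ((x * rconj c (x ^ 2)) ^ 2) = (rconj c (x ^ 2))⁻¹ := by
    rw [rconj_sq, e1, rconj_inv_left, rconj_mul_right, ← rconj_sq,
      rconj_eq_self_of_commute (Commute.refl _)]
  refine ⟨⟨?_, ?_⟩, ?_⟩
  · rw [e2, e1, ← mul_inv_rev, ← h2, h1]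
  · rw [e1, ← mul_inv_rev, ← mul_inv_rev, h2]
  · have e3 : x * rconj c (x ^ 2) * c⁻¹ = x * rconj c x := by rw [h1, h2]; group
    have e4 : x * rconj c (x ^ 2) * (rconj c x)⁻¹ = x * c := by rw [h1]; group
    simp only [fibQuad]
    rw [e1, e2, e3, e4, mul_inv_cancel_right]
    ext a; simp only [Set.mem_insert_iff, Set.mem_singleton_iff]; tauto

/-- Inverting x c gives x⁻¹ (x c⁻¹ x⁻¹), so x c⁻¹ x⁻¹ is the new c for x⁻¹; conjugating it by x
gives c⁻¹. Its sign is opposite to that of c. This carries level 1 to level -1. -/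
theorem IsFibPair.inv {x c : G} (h : IsFibPair x c) :
    rconj (x * c⁻¹ * x⁻¹) (x ^ 2) = x * c⁻¹ * x⁻¹ * rconj (x * c⁻¹ * x⁻¹) x ∧
      x * c⁻¹ * x⁻¹ * rconj (x * c⁻¹ * x⁻¹) x = rconj (x * c⁻¹ * x⁻¹) x * (x * c⁻¹ * x⁻¹) ∧
      (fibQuad x c)⁻¹ = {x⁻¹, x⁻¹ * (x * c⁻¹ * x⁻¹), x⁻¹ * rconj (x * c⁻¹ * x⁻¹) x,
        x⁻¹ * rconj (x * c⁻¹ * x⁻¹) (x ^ 2)} := by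
  obtain ⟨h1, h2⟩ := h
  have e1 : rconj (x * c⁻¹ * x⁻¹) x = c⁻¹ := by simp only [rconj]; group
  have hinj : Function.Injective fun g : G => rconj g x := fun g k hgk => by
    simpa [rconj] using hgk
  refine ⟨hinj ?_, hinj ?_, ?_⟩
  · simp only
    rw [rconj_sq, e1, rconj_mul_left, e1, ← rconj_sq, rconj_inv_left, rconj_inv_left, h1, h2,
      mul_inv_rev]
  · simp only
    rw [e1, rconj_mul_left _ c⁻¹, rconj_mul_left c⁻¹, e1, rconj_inv_left, ← mul_inv_rev, ← mul_inv_rev, h2]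
  · rw [rconj_sq, e1]
    simp only [fibQuad, Set.inv_insert, Set.inv_singleton]
    congr 2
    · group
    · congr 1
      · simp only [rconj]; group
      · simp only [rconj]; group

end Conjugation

/-! ### The presentation and the isomorphism with ℤ² ⋊ ℤ -/

section Presentation

variable {H : Type*} [Group H]

theorem lift_fibRels_eq_one {f : Fin 2 → H} (h : IsFibPair (f 1) (f 0)) :
    ∀ r ∈ fibRels, FreeGroup.lift f r = 1 := by
  intro r hr
  simp only [fibRels, Set.mem_insert_iff, Set.mem_singleton_iff] at hr
  rcases hr with rfl | rfl
  · simp only [map_mul, map_inv, map_rconj, map_pow, FreeGroup.lift_apply_of]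
    rw [h.1, mul_inv_cancel]
  · simp only [map_mul, map_inv, map_rconj, FreeGroup.lift_apply_of]
    rw [h.2, mul_inv_cancel]

namespace FibGroup

/-- The generator `a`. -/
def a : FibGroup := PresentedGroup.of 0

/-- The generator `b`. -/
def b : FibGroup := PresentedGroup.of 1

theorem isFibPair : IsFibPair b a := by
  have h : ∀ r ∈ fibRels, PresentedGroup.mk fibRels r = 1 :=
    fun r hr => PresentedGroup.one_of_mem hr
  have h1 := h (rconj (FreeGroup.of 0) (FreeGroup.of 1 ^ 2) *
    (FreeGroup.of 0 * rconj (FreeGroup.of 0) (FreeGroup.of 1))⁻¹) (by simp [fibRels])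
  have h2 := h ((FreeGroup.of 0 * rconj (FreeGroup.of 0) (FreeGroup.of 1)) *
    (rconj (FreeGroup.of 0) (FreeGroup.of 1) * FreeGroup.of 0)⁻¹) (by simp [fibRels])
  simp only [map_mul, map_inv, map_rconj, map_pow] at h1 h2
  exact ⟨mul_inv_eq_one.mp h1, mul_inv_eq_one.mp h2⟩

/-- The homomorphism out of `FibGroup` given by a pair satisfying the relations. -/
def lift {x c : H} (h : IsFibPair x c) : FibGroup →* H :=
  PresentedGroup.toGroup (f := ![c, x]) (lift_fibRels_eq_one (by simpa using h))

@[simp] theorem lift_a {x c : H} (h : IsFibPair x c) : lift h a = c := by simp [lift, a]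

@[simp] theorem lift_b {x c : H} (h : IsFibPair x c) : lift h b = x := by simp [lift, b]

theorem hom_ext {f g : FibGroup →* H} (ha : f a = g a) (hb : f b = g b) : f = g := by
  refine PresentedGroup.ext fun i => ?_
  fin_cases i
  exacts [ha, hb]

/-- The homomorphism `(u, v) ↦ a ^ u (a ^ b) ^ v`. -/
def ofPlane : Multiplicative (ℤ × ℤ) →* FibGroup where
  toFun p := a ^ p.toAdd.1 * rconj a b ^ p.toAdd.2
  map_one' := by simp
  map_mul' p q := by
    have h : Commute a (rconj a b) := isFibPair.2
    simp only [toAdd_mul, Prod.fst_add, Prod.snd_add, zpow_add]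
    have := (h.zpow_zpow q.toAdd.1 p.toAdd.2).eq
    simp only [mul_assoc]
    rw [← mul_assoc (a ^ q.toAdd.1), this]
    simp only [mul_assoc]

theorem ofPlane_apply (p : Multiplicative (ℤ × ℤ)) :
    ofPlane p = a ^ p.toAdd.1 * rconj a b ^ p.toAdd.2 := rfl

theorem ofPlane_fibAut (p : Multiplicative (ℤ × ℤ)) :
    ofPlane (AddEquiv.toMultiplicative fibAut p) = b⁻¹ * ofPlane p * b := by
  have h : Commute a (rconj a b) := isFibPair.2
  change _ = rconj (ofPlane p) b
  rw [ofPlane_apply, ofPlane_apply, rconj_mul_left, rconj_zpow_left, rconj_zpow_left, ← rconj_sq,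
    isFibPair.1, h.mul_zpow]
  change a ^ p.toAdd.2 * rconj a b ^ (p.toAdd.1 + p.toAdd.2) = _
  rw [zpow_add, ← mul_assoc, ← mul_assoc, (h.zpow_zpow p.toAdd.2 p.toAdd.1).eq]

theorem ofPlane_fibAction (t : Multiplicative ℤ) :
    ofPlane.comp (fibAction t).toMonoidHom =
      (MulAut.conj (zpowersHom FibGroup b t)).toMonoidHom.comp ofPlane := by
  refine MonoidHom.ext fun p => ?_
  simp only [MonoidHom.comp_apply, MulEquiv.toMonoidHom_eq_coe, MonoidHom.coe_coe,
    MulAut.conj_apply, zpowersHom_apply, fibAction]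
  set F : MulAut (Multiplicative (ℤ × ℤ)) := AddEquiv.toMultiplicative fibAut with hF
  have hFp : ∀ p, ofPlane (F p) = b⁻¹ * ofPlane p * b := ofPlane_fibAut
  have hFi : ∀ p, ofPlane (F⁻¹ p) = b * ofPlane p * b⁻¹ := by
    intro p
    have := hFp (F⁻¹ p)
    rw [MulAut.apply_inv_self] at this
    rw [this]; group
  generalize t.toAdd = k
  induction k using Int.induction_on generalizing p with
  | zero => simp
  | succ n ih =>
    rw [zpow_add_one, MulAut.mul_apply, ih, hFi, zpow_add_one]; group
  | pred n ih =>
    rw [zpow_sub_one, MulAut.mul_apply, ih, inv_inv, hFp, zpow_sub_one]; group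

theorem isFibPair_semidirect :
    IsFibPair (SemidirectProduct.inr (φ := fibAction) (Multiplicative.ofAdd (1 : ℤ)))
      (SemidirectProduct.inl (Multiplicative.ofAdd ((1, 0) : ℤ × ℤ))) := by
  have h : ∀ p : ℤ × ℤ, rconj (SemidirectProduct.inl (φ := fibAction) (Multiplicative.ofAdd p))
      (SemidirectProduct.inr (Multiplicative.ofAdd (1 : ℤ))) =
        SemidirectProduct.inl (Multiplicative.ofAdd (fibAut p)) := by
    intro p
    rw [rconj, ← map_inv, ← SemidirectProduct.inl_aut_inv]
    simp [fibAction]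
  refine ⟨?_, ?_⟩
  · rw [rconj_sq, h, h, ← map_mul, ← ofAdd_add]
    simp [fibAut]
  · rw [h, ← MonoidHom.map_mul, ← MonoidHom.map_mul, mul_comm]

/-- The isomorphism with `ℤ² ⋊ ℤ`. -/
def equivSemidirect :
    FibGroup ≃* (Multiplicative (ℤ × ℤ)) ⋊[fibAction] (Multiplicative ℤ) :=
  MonoidHom.toMulEquiv (lift isFibPair_semidirect)
    (SemidirectProduct.lift ofPlane (zpowersHom FibGroup b) ofPlane_fibAction)
    (hom_ext (by simp [ofPlane_apply]) (by simp))
    (by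
      have h : rconj (SemidirectProduct.inl (φ := fibAction)
          (Multiplicative.ofAdd ((1, 0) : ℤ × ℤ)))
          (SemidirectProduct.inr (Multiplicative.ofAdd (1 : ℤ))) =
          SemidirectProduct.inl (Multiplicative.ofAdd ((0, 1) : ℤ × ℤ)) := by
        rw [rconj, ← map_inv, ← SemidirectProduct.inl_aut_inv]
        simp [fibAction, fibAut]
      refine SemidirectProduct.hom_ext ?_ ?_
      · refine MonoidHom.ext fun p => ?_
        simp only [MonoidHom.comp_apply, SemidirectProduct.lift_inl, ofPlane_apply, map_mul,
          map_zpow, map_rconj, lift_a, lift_b, MonoidHom.id_apply, h]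
        rw [← MonoidHom.map_zpow, ← MonoidHom.map_zpow, ← MonoidHom.map_mul, ← ofAdd_zsmul,
          ← ofAdd_zsmul, ← ofAdd_add]
        simp
      · refine MonoidHom.ext fun t => ?_
        simp only [MonoidHom.comp_apply, SemidirectProduct.lift_inr, zpowersHom_apply,
          map_zpow, lift_b, MonoidHom.id_apply]
        rw [← map_zpow, ← ofAdd_zsmul]
        simp)

/-- The normal form inherited from the semidirect product; it makes the kernel of the map to
`FibAff` computable. -/
theorem exists_eq_ofPlane_mul_zpow (g : FibGroup) :
    ∃ u v k : ℤ, g = a ^ u * rconj a b ^ v * b ^ k := by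
  obtain ⟨s, rfl⟩ := equivSemidirect.symm.surjective g
  exact ⟨s.left.toAdd.1, s.left.toAdd.2, s.right.toAdd, rfl⟩

end FibGroup

end Presentation

/-! ### The ordered group ℤ ⋉ ℝ -/

open scoped goldenRatio

/-- Lower bounds for product sets are obtained by exhibiting a strictly increasing list of products.
-/
theorem Finset.length_le_card_of_isChain {α : Type*} [LinearOrder α] {A : Finset α} (l : List α)
    (hl : l.IsChain (· < ·)) (hA : ∀ a ∈ l, a ∈ A) : l.length ≤ A.card := by
  rw [← List.toFinset_card_of_nodup (List.isChain_iff_pairwise.mp hl).nodup]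
  exact Finset.card_le_card fun a ha => hA a (List.mem_toFinset.mp ha)

theorem four_le_card_pair_mul_pair {G : Type*} [Group G] [LinearOrder G] [MulLeftMono G]
    [MulRightMono G] {a b c d : G} (hab : a < b) (hcd : c < d) (hne : a * d ≠ b * c) :
    4 ≤ (({a, b} : Finset G) * {c, d}).card := by
  rcases lt_or_gt_of_ne hne with h | h
  · refine Finset.length_le_card_of_isChain [a * c, a * d, b * c, b * d] ?_ ?_
    · simp [h, hcd]
    · simp [Finset.mul_mem_mul]
  · refine Finset.length_le_card_of_isChain [a * c, b * c, a * d, b * d] ?_ ?_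
    · simp [h, hab]
    · simp [Finset.mul_mem_mul]

theorem goldenRatio_zpow_eq_one_iff {n : ℤ} : φ ^ n = 1 ↔ n = 0 :=
  zpow_eq_one_iff_right₀ Real.goldenRatio_pos.le Real.one_lt_goldenRatio.ne'

/-- 2 lies strictly between the consecutive powers φ and φ² = φ + 1. -/
theorem goldenRatio_zpow_ne_two (n : ℤ) : φ ^ n ≠ 2 := by
  intro h
  rcases le_or_gt n 1 with hn | hn
  · have := zpow_le_zpow_right₀ Real.one_lt_goldenRatio.le hn
    rw [zpow_one] at this
    linarith [Real.goldenRatio_lt_two]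
  · have := zpow_le_zpow_right₀ Real.one_lt_goldenRatio.le (show (2 : ℤ) ≤ n by omega)
    have h2 : φ ^ (2 : ℤ) = φ + 1 := by exact_mod_cast Real.goldenRatio_sq
    linarith [Real.one_lt_goldenRatio]

/-- The group `ℤ ⋉ ℝ` in which the generator of `ℤ` acts on `ℝ` by right conjugation as
multiplication by the golden ratio. -/
@[ext]
structure FibAff where
  /-- The component in `ℤ`. -/
  lev : ℤ
  /-- The component in `ℝ`. -/
  val : ℝ

namespace FibAff

noncomputable instance : Mul FibAff := ⟨fun x y => ⟨x.lev + y.lev, φ ^ y.lev * x.val + y.val⟩⟩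
noncomputable instance : One FibAff := ⟨⟨0, 0⟩⟩
noncomputable instance : Inv FibAff := ⟨fun x => ⟨-x.lev, -(φ ^ (-x.lev) * x.val)⟩⟩

@[simp] theorem mul_lev (x y : FibAff) : (x * y).lev = x.lev + y.lev := rfl
@[simp] theorem mul_val (x y : FibAff) : (x * y).val = φ ^ y.lev * x.val + y.val := rfl
@[simp] theorem one_lev : (1 : FibAff).lev = 0 := rfl
@[simp] theorem one_val : (1 : FibAff).val = 0 := rfl
@[simp] theorem inv_lev (x : FibAff) : x⁻¹.lev = -x.lev := rfl
@[simp] theorem inv_val (x : FibAff) : x⁻¹.val = -(φ ^ (-x.lev) * x.val) := rfl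

noncomputable instance : Group FibAff :=
  Group.ofLeftAxioms
    (fun x y z => by
      ext
      · simp [add_assoc]
      · simp only [mul_val, mul_lev, zpow_add₀ Real.goldenRatio_ne_zero]; ring)
    (fun x => by ext <;> simp)
    (fun x => by
      ext
      · simp
      · simp only [mul_val, inv_val, one_val, zpow_neg]
        field_simp [zpow_ne_zero x.lev Real.goldenRatio_ne_zero]
        ring)

noncomputable instance : LinearOrder FibAff :=
  LinearOrder.lift' (fun x => toLex (x.lev, x.val)) fun x y h => by
    have := Prod.ext_iff.mp (toLex_inj.mp h)
    exact FibAff.ext this.1 this.2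

theorem lt_iff {x y : FibAff} : x < y ↔ x.lev < y.lev ∨ x.lev = y.lev ∧ x.val < y.val :=
  Prod.Lex.toLex_lt_toLex

theorem le_iff {x y : FibAff} : x ≤ y ↔ x.lev < y.lev ∨ x.lev = y.lev ∧ x.val ≤ y.val :=
  Prod.Lex.toLex_le_toLex

theorem lev_le_of_le {x y : FibAff} (h : x ≤ y) : x.lev ≤ y.lev := by
  rcases le_iff.mp h with h | h
  · exact h.le
  · exact h.1.le

theorem val_lt_of_lt {x y : FibAff} (h : x < y) (hl : x.lev = y.lev) : x.val < y.val := by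
  rcases lt_iff.mp h with h | h
  · omega
  · exact h.2

instance : MulLeftMono FibAff := ⟨fun z x y h => by
  rcases le_iff.mp h with h | h
  · exact le_iff.mpr (Or.inl (by simpa using h))
  · exact le_iff.mpr (Or.inr ⟨by simp [h.1], by simp [h.1, h.2]⟩)⟩

instance : MulRightMono FibAff := ⟨fun z x y h => by
  rcases le_iff.mp h with h | h
  · exact le_iff.mpr (Or.inl (by simpa [Function.swap] using h))
  · refine le_iff.mpr (Or.inr ⟨by simp [Function.swap, h.1], ?_⟩)
    have := zpow_pos Real.goldenRatio_pos z.lev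
    simp only [Function.swap, mul_val]
    gcongr
    exact h.2⟩

theorem commute_iff {x y : FibAff} :
    Commute x y ↔ x.val * (φ ^ y.lev - 1) = y.val * (φ ^ x.lev - 1) := by
  constructor
  · intro h
    have := congrArg val h.eq
    simp only [mul_val] at this
    linarith
  · intro h
    ext
    · simp [add_comm]
    · simp only [mul_val]; linarith

/-- By `commute_iff`, commuting means that the vectors (val, φ^lev - 1) are proportional. Only the
identity has the zero vector, so proportionality passes through any nontrivial `y`. -/
theorem isCommTransitive : IsCommTransitive FibAff := by
  intro x y z hy hxy hyz
  rw [commute_iff] at *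
  by_cases h : φ ^ y.lev - 1 = 0
  · have hl : y.lev = 0 := goldenRatio_zpow_eq_one_iff.mp (by linarith)
    have hv : y.val ≠ 0 := fun hv => hy (FibAff.ext hl hv)
    rw [h, mul_zero] at hxy hyz
    have h1 := (mul_eq_zero.mp hxy.symm).resolve_left hv
    have h2 := (mul_eq_zero.mp hyz).resolve_left hv
    rw [h1, h2]; simp
  · apply mul_left_cancel₀ h
    linear_combination (φ ^ z.lev - 1) * hxy + (φ ^ x.lev - 1) * hyz

theorem not_commute_of_lev_eq {x y : FibAff} (hne : x ≠ y) (hl : x.lev = y.lev)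
    (h0 : x.lev ≠ 0) : ¬ Commute x y := by
  rw [commute_iff, ← hl]
  intro h
  have h1 : φ ^ x.lev - 1 ≠ 0 := fun h => h0 (goldenRatio_zpow_eq_one_iff.mp (by linarith))
  exact hne (FibAff.ext hl (mul_right_cancel₀ h1 h))

theorem lev_ne_zero_of_not_commute {x y : FibAff} (h : ¬ Commute x y) (hy : y.lev = 0) :
    x.lev ≠ 0 := by
  intro hx
  exact h (commute_iff.mpr (by simp [hx, hy]))

/-- Adding an element of a new level to a noncommutative set contained in one level. -/
theorem card_mul_self_insert_of_lev_ne {T : Finset FibAff} {e : FibAff} {n : ℤ}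
    (hT : HasNoncommPair T) (hn : ∀ x ∈ T, x.lev = n) (he : e.lev ≠ n) (hc : 3 ≤ T.card) :
    3 * (insert e T).card ≤ (insert e T * insert e T).card + 1 := by
  have heT : e ∉ T := fun h => he (hn e h)
  have h1 := three_mul_card_le_card_mul_self_add_two isCommTransitive hT
  have hcard : ({e} * T).card = T.card := by
    rw [Finset.singleton_mul]; exact Finset.card_image_of_injective _ (mul_right_injective e)
  have hee : e * e ∉ {e} * T := by
    intro hm
    obtain ⟨p, hp, s, hs, hps⟩ := Finset.mem_mul.mp hm
    obtain rfl := Finset.mem_singleton.mp hp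
    exact heT (mul_left_cancel hps ▸ hs)
  have h2 := Finset.card_add_le_of_new (A := insert e T * insert e T) (B := T * T)
    (C := insert (e * e) ({e} * T))
    (Finset.mul_subset_mul (Finset.subset_insert _ _) (Finset.subset_insert _ _)) ?_
  · rw [Finset.card_insert_of_notMem hee] at h2
    rw [Finset.card_insert_of_notMem heT]
    -- The levels give (3|T| - 2) + |T| + 1 products, which is at least 3(|T| + 1) - 1 exactly
    -- because |T| ≥ 3.
    omega
  intro c hc'
  have hlev : ∀ d ∈ T * T, d.lev = 2 * n := by
    intro d hd
    obtain ⟨p, hp, q, hq, rfl⟩ := Finset.mem_mul.mp hd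
    rw [mul_lev, hn p hp, hn q hq]; ring
  rcases Finset.mem_insert.mp hc' with rfl | hc'
  · refine ⟨Finset.mul_mem_mul (by simp) (by simp), fun hm => ?_⟩
    have := hlev _ hm
    rw [mul_lev] at this; omega
  · obtain ⟨p, hp, s, hs, rfl⟩ := Finset.mem_mul.mp hc'
    obtain rfl := Finset.mem_singleton.mp hp
    refine ⟨Finset.mul_mem_mul (by simp) (by simp [hs]), fun hm => ?_⟩
    have := hlev _ hm
    rw [mul_lev, hn s hs] at this; omega

/-- Removing a nontrivial element which is alone in the top level loses four products. -/
theorem card_mul_self_add_four_le_of_lev_lt {T : Finset FibAff} {x : FibAff}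
    (hS : HasNoncommPair (insert x T)) (hx : ∀ y ∈ T, y.lev < x.lev) (hx1 : x ≠ 1)
    (hc : 2 ≤ T.card) : (T * T).card + 4 ≤ (insert x T * insert x T).card := by
  have hsub : T * T ⊆ insert x T * insert x T :=
    Finset.mul_subset_mul (Finset.subset_insert _ _) (Finset.subset_insert _ _)
  have hxT : ∀ y ∈ T, x ≠ y := by
    rintro y hy rfl; exact (hx _ hy).false
  have key : ∀ a b c d : FibAff, a ≠ b → a ≠ c → a ≠ d → b ≠ c → b ≠ d → c ≠ d →
      (∀ e, e = a ∨ e = b ∨ e = c ∨ e = d → e ∈ insert x T * insert x T ∧ e ∉ T * T) →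
      (T * T).card + 4 ≤ (insert x T * insert x T).card := by
    intro a b c d hab hac had hbc hbd hcd h
    have h4 : ({a, b, c, d} : Finset FibAff).card = 4 := by simp [hab, hac, had, hbc, hbd, hcd]
    rw [← h4]
    exact Finset.card_add_le_of_new hsub fun e he => h e (by simpa using he)
  have hmemx : ∀ y ∈ T, x * y ∈ insert x T * insert x T := fun y hy =>
    Finset.mul_mem_mul (by simp) (by simp [hy])
  have hmemx' : ∀ y ∈ T, y * x ∈ insert x T * insert x T := fun y hy =>
    Finset.mul_mem_mul (by simp [hy]) (by simp)
  obtain ⟨y, hy, -, hymax⟩ := T.exists_maximal_filter (fun _ => True)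
    (by obtain ⟨y, hy⟩ := Finset.card_pos.mp (show 0 < T.card by omega); exact ⟨y, hy, trivial⟩)
  have hylev : ∀ u ∈ T, u.lev ≤ y.lev := fun u hu => lev_le_of_le (hymax u hu trivial)
  have hnewlev : ∀ d : FibAff, x.lev + y.lev ≤ d.lev → d ∉ T * T := by
    intro d hd hm
    obtain ⟨p, hp, q, hq, rfl⟩ := Finset.mem_mul.mp hm
    have := hx p hp
    have := hylev q hq
    rw [mul_lev] at hd; omega
  have hxx : x * x ∈ insert x T * insert x T ∧ x * x ∉ T * T :=
    ⟨Finset.mul_mem_mul (by simp) (by simp), hnewlev _ (by have := hx y hy; simp; omega)⟩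
  -- If `x` commutes with the whole top level of `T`, both `x * z` and `z * x` are new for a maximal
  -- `z` not commuting with `x`: by levels, factors of either in `T` would lie above `z` and commute
  -- with `x`.
  by_cases hall : ∀ u ∈ T, u.lev = y.lev → Commute x u
  · have hxy := hall y hy rfl
    obtain ⟨z, hz, hzc, hzmax⟩ := T.exists_maximal_filter (fun w => ¬ Commute x w) (by
      obtain ⟨z, hz, hxz⟩ := hS.exists_of_ne_one isCommTransitive hx1
      have hzx : z ≠ x := by rintro rfl; exact hxz (Commute.refl _)
      exact ⟨z, Finset.mem_of_mem_insert_of_ne hz hzx, hxz⟩)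
    have hcomm : ∀ u ∈ T, z.lev < u.lev → Commute x u := by
      intro u hu hlt
      by_contra hcu
      have := lev_le_of_le (hzmax u hu hcu)
      omega
    have hnotC : ∀ d, d = x * z ∨ d = z * x → ¬ Commute x d := by
      rintro d (rfl | rfl) hcd
      · exact hzc (hcd.mul_left_cancel_of (Commute.refl x))
      · exact hzc (hcd.mul_right_cancel_of (Commute.refl x))
    have hnew : ∀ d, d = x * z ∨ d = z * x → d ∉ T * T := by
      intro d hd hm
      have hdl : d.lev = x.lev + z.lev := by
        rcases hd with rfl | rfl
        · simp
        · simp [add_comm]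
      obtain ⟨p, hp, q, hq, hpq⟩ := Finset.mem_mul.mp hm
      rw [← hpq, mul_lev] at hdl
      have hp' := hx p hp
      have hq' := hx q hq
      exact hnotC d hd (hpq ▸ (hcomm p hp (by omega)).mul_right (hcomm q hq (by omega)))
    have hCxx : Commute x (x * x) := (Commute.refl x).mul_right (Commute.refl x)
    have hCxy : Commute x (x * y) := (Commute.refl x).mul_right hxy
    refine key (x * x) (x * y) (x * z) (z * x) (fun h => hxT y hy (mul_left_cancel h))
      (fun h => hnotC _ (Or.inl rfl) (h ▸ hCxx)) (fun h => hnotC _ (Or.inr rfl) (h ▸ hCxx))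
      (fun h => hnotC _ (Or.inl rfl) (h ▸ hCxy)) (fun h => hnotC _ (Or.inr rfl) (h ▸ hCxy))
      hzc ?_
    rintro e (rfl | rfl | rfl | rfl)
    · exact hxx
    · exact ⟨hmemx y hy, hnewlev _ (by simp)⟩
    · exact ⟨hmemx z hz, hnew _ (Or.inl rfl)⟩
    · exact ⟨hmemx' z hz, hnew _ (Or.inr rfl)⟩
  · push Not at hall
    obtain ⟨v, hv, hvl, hxv⟩ := hall
    -- A second element in the level of `v` gives three translates by `x`, besides `x * x`.
    -- Otherwise take `z` largest apart from `v`: a product in `T * T` at the level of `x * z` must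
    -- be `v * v`. If it equalled both `x * z` and `z * x`, then `x` would commute with `v * v`,
    -- hence with `v`.
    by_cases hsec : ∃ w ∈ T, w ≠ v ∧ w.lev = y.lev
    · obtain ⟨w, hw, hwv, hwl⟩ := hsec
      have hsub2 : ∀ u ∈ ({v, w} : Finset FibAff), u ∈ T ∧ u.lev = y.lev := by
        intro u hu
        rcases Finset.mem_insert.mp hu with rfl | hu
        · exact ⟨hv, hvl⟩
        · obtain rfl := Finset.mem_singleton.mp hu
          exact ⟨hw, hwl⟩
      have h3 := card_add_one_le_card_translates (T := {v, w}) (x := x) ⟨v, by simp, hxv⟩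
      rw [Finset.card_pair hwv.symm] at h3
      have hlevU : ∀ d ∈ ({x} * {v, w} ∪ {v, w} * {x} : Finset FibAff),
          d ∈ insert x T * insert x T ∧ d.lev = x.lev + y.lev := by
        intro d hd
        rcases Finset.mem_union.mp hd with hd | hd
        · obtain ⟨p, hp, s, hs, rfl⟩ := Finset.mem_mul.mp hd
          obtain rfl := Finset.mem_singleton.mp hp
          exact ⟨hmemx s (hsub2 s hs).1, by rw [mul_lev, (hsub2 s hs).2]⟩
        · obtain ⟨s, hs, p, hp, rfl⟩ := Finset.mem_mul.mp hd
          obtain rfl := Finset.mem_singleton.mp hp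
          exact ⟨hmemx' s (hsub2 s hs).1, by rw [mul_lev, (hsub2 s hs).2, add_comm]⟩
      have hnot : x * x ∉ ({x} * {v, w} ∪ {v, w} * {x} : Finset FibAff) := by
        intro hm
        have h5 := (hlevU _ hm).2
        have := hx y hy
        rw [mul_lev] at h5; omega
      have h4 := Finset.card_add_le_of_new hsub
        (C := insert (x * x) ({x} * {v, w} ∪ {v, w} * {x})) (by
          intro c hc'
          rcases Finset.mem_insert.mp hc' with rfl | hc'
          · exact hxx
          · exact ⟨(hlevU c hc').1, hnewlev _ (hlevU c hc').2.ge⟩)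
      rw [Finset.card_insert_of_notMem hnot] at h4
      omega
    · push Not at hsec
      obtain ⟨z, hz, hzv, hzmax⟩ := T.exists_maximal_filter (fun w => w ≠ v) (by
        obtain ⟨w, hw, hwv⟩ := Finset.exists_mem_ne (show 1 < T.card by omega) v
        exact ⟨w, hw, hwv⟩)
      have huniq : ∀ u ∈ T, z.lev < u.lev → u = v := by
        intro u hu hlt
        by_contra huv
        have := lev_le_of_le (hzmax u hu huv)
        omega
      have hzl : z.lev < y.lev := lt_of_le_of_ne (hylev z hz) (hsec z hz hzv)
      have hform : ∀ d, d.lev = x.lev + z.lev → d ∈ T * T → d = v * v := by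
        intro d hdl hm
        obtain ⟨p, hp, q, hq, hpq⟩ := Finset.mem_mul.mp hm
        rw [← hpq, mul_lev] at hdl
        have hp' := hx p hp
        have hq' := hx q hq
        rw [← hpq, huniq p hp (by omega), huniq q hq (by omega)]
      have hv1 : v ≠ 1 := by rintro rfl; exact hxv (Commute.one_right x)
      have hex : ∃ d, (d = x * z ∨ d = z * x) ∧ d ∉ T * T := by
        by_contra! hcon
        have h1 := hform _ rfl (hcon _ (Or.inl rfl))
        have h2 := hform (z * x) (by simp [add_comm]) (hcon _ (Or.inr rfl))
        have hcz : Commute x z := h1.trans h2.symm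
        have hcv : Commute x (v * v) := h1 ▸ (Commute.refl x).mul_right hcz
        exact hxv (isCommTransitive x (v * v) v (mul_self_ne_one_of_ne_one hv1) hcv
          ((Commute.refl v).mul_left (Commute.refl v)))
      obtain ⟨d, hd, hdT⟩ := hex
      have hdl : d.lev = x.lev + z.lev := by
        rcases hd with rfl | rfl
        · simp
        · simp [add_comm]
      have hdS : d ∈ insert x T * insert x T := by
        rcases hd with rfl | rfl
        · exact hmemx z hz
        · exact hmemx' z hz
      have hyx := hx y hy
      have hne : ∀ e : FibAff, x.lev + z.lev < e.lev → e ≠ d := by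
        rintro e he rfl; omega
      refine key (x * x) (x * v) (v * x) d (fun h => hxT v hv (mul_left_cancel h))
        (fun h => hxT v hv (mul_right_cancel h)) (hne _ (by simp; omega)) hxv
        (hne _ (by simp; omega)) (hne _ (by simp; omega)) ?_
      rintro e (rfl | rfl | rfl | rfl)
      · exact hxx
      · exact ⟨hmemx v hv, hnewlev _ (by simp; omega)⟩
      · exact ⟨hmemx' v hv, hnewlev _ (by simp; omega)⟩
      · exact ⟨hdS, hdT⟩

end FibAff

/-! ### Sets spread over at least two levels -/

namespace FibAff

/-- A nonzero `a` would make φ^n one of the positive ratios 1, 2, 1/2, none of which is a nontrivial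
power of φ. -/
theorem eq_zero_of_int_eq_goldenRatio_zpow_mul {n : ℤ} (hn : n ≠ 0) {a b : ℤ} (ha : |a| ≤ 2)
    (hb : |b| ≤ 2) (h : (a : ℝ) = φ ^ n * b) : a = 0 := by
  have h0 := zpow_pos Real.goldenRatio_pos n
  have h1 : φ ^ n ≠ 1 := fun h => hn (goldenRatio_zpow_eq_one_iff.mp h)
  have h2 := goldenRatio_zpow_ne_two n
  have h3 : φ ^ n ≠ 1 / 2 := by
    intro h
    apply goldenRatio_zpow_ne_two (-n)
    rw [zpow_neg, h]; norm_num
  rw [abs_le] at ha hb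
  obtain ⟨ha1, ha2⟩ := ha
  obtain ⟨hb1, hb2⟩ := hb
  by_contra hne
  generalize φ ^ n = q at *
  interval_cases a <;> interval_cases b <;> push_cast at h <;>
    first
    | exact hne rfl
    | nlinarith
    | exact h1 (by linarith)
    | exact h2 (by linarith)
    | exact h3 (by linarith)

/-- Three commuting elements and an element not commuting with them. -/
theorem eleven_le_card_of_commute {T : Finset FibAff} {x : FibAff} (hT : ¬ HasNoncommPair T)
    (hc : T.card = 3) (hx : ∃ t ∈ T, ¬ Commute x t) :
    11 ≤ (insert x T * insert x T).card := by
  have hmain := card_mul_self_insert_ge isCommTransitive hT hx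
  have hU : ({x} * T ∪ T * {x}).card + (({x} * T) ∩ (T * {x})).card = 6 := by
    rw [Finset.card_union_add_card_inter, Finset.card_singleton_mul, Finset.card_mul_singleton,
      hc]
  have hne : T.Nonempty := Finset.card_pos.mp (by omega)
  have hTT := cauchy_davenport_mul_of_linearOrder_isCancelMul hne hne
  -- The count is either 5 + 5 + 1 or 6 + 4 + 1.
  suffices (({x} * T) ∩ (T * {x})).card ≤ 1 ∨ 6 ≤ (T * T).card by
    rcases this with h | h
    · omega
    · have := card_add_one_le_card_translates hx
      omega
  -- If `T` leaves level 0, its elements are determined by their levels, so `x * u = v * x` forces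
  -- `u = v`, and then `u = 1`. In level 0, `T` is a triple of reals: it has six sums unless it is
  -- an arithmetic progression.
  by_cases hlev : ∃ g ∈ T, g.lev ≠ 0
  · left
    obtain ⟨g, hg, hg0⟩ := hlev
    have hTg : ∀ u ∈ T, Commute g u := by
      intro u hu; by_contra hcu; exact hT ⟨g, hg, u, hu, hcu⟩
    suffices ∀ d ∈ ({x} * T) ∩ (T * {x}), d = x from
      Finset.card_le_one.mpr fun a ha b hb => (this a ha).trans (this b hb).symm
    intro d hd
    obtain ⟨hd1, hd2⟩ := Finset.mem_inter.mp hd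
    obtain ⟨p, hp, u, hu, hpu⟩ := Finset.mem_mul.mp hd1
    obtain ⟨v, hv, q, hq, hvq⟩ := Finset.mem_mul.mp hd2
    obtain rfl := Finset.mem_singleton.mp hp
    obtain rfl := Finset.mem_singleton.mp hq
    have heq : q * u = v * q := hpu.trans hvq.symm
    have hl : u.lev = v.lev := by
      have := congrArg lev heq
      simp only [mul_lev] at this; omega
    have huv : u = v := by
      have h1 := commute_iff.mp (hTg u hu)
      have h2 := commute_iff.mp (hTg v hv)
      rw [hl] at h1
      have hgz : φ ^ g.lev - 1 ≠ 0 := fun h => hg0 (goldenRatio_zpow_eq_one_iff.mp (by linarith))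
      exact FibAff.ext hl (mul_right_cancel₀ hgz (h1.symm.trans h2))
    subst huv
    by_contra hne'
    have hu1 : u ≠ 1 := by rintro rfl; exact hne' (by rw [← hpu, mul_one])
    obtain ⟨t, ht, hxt⟩ := hx
    refine hxt (isCommTransitive q u t hu1 heq ?_)
    by_contra hcu; exact hT ⟨u, hu, t, ht, hcu⟩
  · push Not at hlev
    have hx0 : x.lev ≠ 0 := by
      obtain ⟨t, ht, hxt⟩ := hx
      exact lev_ne_zero_of_not_commute hxt (hlev t ht)
    obtain ⟨r, T', rfl, -, hc', hr⟩ := Finset.exists_insert_max hc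
    obtain ⟨q, T', rfl, -, hc', hq⟩ := Finset.exists_insert_max hc'
    obtain ⟨p, rfl⟩ := Finset.card_eq_one.mp hc'
    have hpq : p < q := hq p (by simp)
    have hqr : q < r := hr q (by simp)
    have hp0 := hlev p (by simp)
    have hq0 := hlev q (by simp)
    have hr0 := hlev r (by simp)
    by_cases hap : p.val + r.val = q.val + q.val
    · left
      have hd : 0 < q.val - p.val := sub_pos.mpr (val_lt_of_lt hpq (hp0.trans hq0.symm))
      have hform : ∀ u ∈ (insert r (insert q {p}) : Finset FibAff), ∃ i : ℤ, 0 ≤ i ∧ i ≤ 2 ∧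
          u.val = p.val + i * (q.val - p.val) := by
        intro u hu
        simp only [Finset.mem_insert, Finset.mem_singleton] at hu
        rcases hu with rfl | rfl | rfl
        · exact ⟨2, by norm_num, by norm_num, by push_cast; linarith⟩
        · exact ⟨1, by norm_num, by norm_num, by push_cast; ring⟩
        · exact ⟨0, by norm_num, by norm_num, by push_cast; ring⟩
      have hel : ∀ a ∈ (({x} * insert r (insert q {p})) ∩ (insert r (insert q {p}) * {x}) : Finset FibAff),
          ∃ i j : ℤ, 0 ≤ i ∧ i ≤ 2 ∧ 0 ≤ j ∧ j ≤ 2 ∧ a.lev = x.lev ∧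
            a.val = x.val + (p.val + i * (q.val - p.val)) ∧
            a.val = φ ^ x.lev * (p.val + j * (q.val - p.val)) + x.val := by
        intro d hd
        obtain ⟨hd1, hd2⟩ := Finset.mem_inter.mp hd
        obtain ⟨p', hp', u, hu, rfl⟩ := Finset.mem_mul.mp hd1
        obtain ⟨v, hv, q', hq', hvq⟩ := Finset.mem_mul.mp hd2
        obtain rfl := Finset.mem_singleton.mp hp'
        obtain rfl := Finset.mem_singleton.mp hq'
        obtain ⟨i, hi0, hi2, hi⟩ := hform u hu
        obtain ⟨j, hj0, hj2, hj⟩ := hform v hv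
        refine ⟨i, j, hi0, hi2, hj0, hj2, by simp [hlev u hu], ?_, ?_⟩
        · rw [mul_val, hlev u hu, hi]; simp
        · rw [← hvq, mul_val, hj]
      rw [Finset.card_le_one]
      intro a ha b hb
      obtain ⟨i, j, hi0, hi2, hj0, hj2, hal, hai, haj⟩ := hel a ha
      obtain ⟨i', j', hi0', hi2', hj0', hj2', hbl, hbi, hbj⟩ := hel b hb
      -- Two common elements of the translates yield i - i' = φ^n (j - j') with differences at most
      -- 2 in absolute value.
      have hz : i - i' = 0 := by
        refine eq_zero_of_int_eq_goldenRatio_zpow_mul hx0 (b := j - j')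
          (abs_le.mpr ⟨by omega, by omega⟩) (abs_le.mpr ⟨by omega, by omega⟩) ?_
        apply mul_right_cancel₀ hd.ne'
        push_cast
        linear_combination haj - hai - hbj + hbi
      have hii : i = i' := by omega
      subst hii
      exact FibAff.ext (hal.trans hbl.symm) (hai.trans hbi.symm)
    · right
      have hne' : p * r ≠ q * q := by
        intro h
        have := congrArg val h
        simp only [mul_val, hr0, hq0, zpow_zero, one_mul] at this
        exact hap this
      have hpr := hpq.trans hqr
      rcases lt_or_gt_of_ne hne' with h | h
      · refine Finset.length_le_card_of_isChain [p * p, p * q, p * r, q * q, q * r, r * r] ?_ ?_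
        · simp [h, hpq, hqr]
        · simp [Finset.mul_mem_mul]
      · refine Finset.length_le_card_of_isChain [p * p, p * q, q * q, p * r, q * r, r * r] ?_ ?_
        · simp [h, hpq, hqr]
        · simp [Finset.mul_mem_mul]

theorem eleven_le_card_of_lev_lt {T : Finset FibAff} {x : FibAff}
    (hS : HasNoncommPair (insert x T)) (hx : ∀ y ∈ T, y.lev < x.lev) (hx1 : x ≠ 1)
    (hc : T.card = 3) : 11 ≤ (insert x T * insert x T).card := by
  by_cases hT : HasNoncommPair T
  · have := three_mul_card_le_card_mul_self_add_two isCommTransitive hT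
    have := card_mul_self_add_four_le_of_lev_lt hS hx hx1 (by omega)
    omega
  · obtain ⟨z, hz, hxz⟩ := hS.exists_of_ne_one isCommTransitive hx1
    have hzx : z ≠ x := by rintro rfl; exact hxz (Commute.refl _)
    exact eleven_le_card_of_commute hT hc ⟨z, Finset.mem_of_mem_insert_of_ne hz hzx, hxz⟩

theorem eleven_le_card_of_lt_lev {T : Finset FibAff} {x : FibAff}
    (hS : HasNoncommPair (insert x T)) (hx : ∀ y ∈ T, x.lev < y.lev) (hx1 : x ≠ 1)
    (hc : T.card = 3) : 11 ≤ (insert x T * insert x T).card := by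
  have h := eleven_le_card_of_lev_lt (T := T⁻¹) (x := x⁻¹)
    (by simpa [Finset.inv_insert] using hS.inv)
    (fun y hy => by
      have := hx _ (Finset.mem_inv'.mp hy)
      simp only [inv_lev] at this ⊢; omega)
    (by simpa using hx1) (by simpa using hc)
  rwa [← Finset.inv_insert, card_inv_mul_inv] at h

/-- The case where the identity is alone on top, so that deleting it need not lose four products. If
`y₃` lies above the pair, the other three elements already give 4 + 4 products, and 1, `y₃` and one
of `y₁`, `y₂` are new: by levels only `y₃ * y₃` could equal `y₁` or `y₂`. -/
theorem eleven_le_card_of_one {y₁ y₂ y₃ : FibAff} (h12 : y₁ ≠ y₂) (hl : y₂.lev = y₁.lev)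
    (h0 : y₁.lev < 0) (h13 : y₁.lev ≤ y₃.lev) (h3 : y₃.lev < 0) (h31 : y₃ ≠ y₁) (h32 : y₃ ≠ y₂) :
    11 ≤ (({1, y₃, y₁, y₂} : Finset FibAff) * {1, y₃, y₁, y₂}).card := by
  have hNC : HasNoncommPair ({y₁, y₂} : Finset FibAff) :=
    ⟨y₁, by simp, y₂, by simp, not_commute_of_lev_eq h12 hl.symm h0.ne⟩
  have hNC3 : HasNoncommPair ({y₃, y₁, y₂} : Finset FibAff) := hNC.mono (by simp)
  have hc2 : ({y₁, y₂} : Finset FibAff).card = 2 := Finset.card_pair h12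
  have hc3 : ({y₃, y₁, y₂} : Finset FibAff).card = 3 := by simp [h12, h31, h32]
  have hne : ∀ y : FibAff, y.lev < 0 → (1 : FibAff) ≠ y := by
    rintro y hy rfl; simp at hy
  have hc4 : ({1, y₃, y₁, y₂} : Finset FibAff).card = 4 := by
    simp [h12, h31, h32, hne y₃ h3, hne y₁ h0, hne y₂ (hl ▸ h0)]
  rcases h13.eq_or_lt with h13 | h13
  · have := card_mul_self_insert_of_lev_ne (e := 1) (n := y₁.lev) hNC3
      (by simp [hl, h13]) h0.ne' hc3.ge
    omega
  · have h1 := three_mul_card_le_card_mul_self_add_two isCommTransitive hNC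
    have h2 := card_mul_self_add_four_le_of_lev_lt hNC3 (by simp [hl, h13])
      (hne y₃ h3).symm hc2.ge
    have hlevs : ∀ d ∈ ({y₃, y₁, y₂} : Finset FibAff) * {y₃, y₁, y₂},
        d.lev < y₃.lev ∧ (d.lev = y₁.lev → d = y₃ * y₃) := by
      intro d hd
      obtain ⟨p, hp, q, hq, rfl⟩ := Finset.mem_mul.mp hd
      have hcase : ∀ u ∈ ({y₃, y₁, y₂} : Finset FibAff), u = y₃ ∨ u.lev = y₁.lev := by
        intro u hu
        simp only [Finset.mem_insert, Finset.mem_singleton] at hu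
        rcases hu with rfl | rfl | rfl
        exacts [Or.inl rfl, Or.inr rfl, Or.inr hl]
      rw [mul_lev]
      rcases hcase p hp with rfl | hp <;> rcases hcase q hq with rfl | hq
      · exact ⟨by omega, fun _ => rfl⟩
      all_goals exact ⟨by omega, fun _ => by omega⟩
    obtain ⟨y, hy, hyT⟩ : ∃ y, (y = y₁ ∨ y = y₂) ∧ y ∉ ({y₃, y₁, y₂} : Finset FibAff) *
        {y₃, y₁, y₂} := by
      by_contra! hcon
      exact h12 (((hlevs _ (hcon y₁ (Or.inl rfl))).2 rfl).trans
        ((hlevs _ (hcon y₂ (Or.inr rfl))).2 hl).symm)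
    have hyl : y.lev = y₁.lev := by rcases hy with rfl | rfl; exacts [rfl, hl]
    have hyS : y ∈ ({1, y₃, y₁, y₂} : Finset FibAff) := by rcases hy with rfl | rfl <;> simp
    have hy3 : y₃ ≠ y := by rintro rfl; omega
    have hc : ({1, y₃, y} : Finset FibAff).card = 3 := by
      simp [hy3, hne y₃ h3, hne y (by omega)]
    have h4 := Finset.card_add_le_of_new (C := {1, y₃, y})
      (Finset.mul_subset_mul (Finset.subset_insert 1 ({y₃, y₁, y₂} : Finset FibAff))
        (Finset.subset_insert 1 ({y₃, y₁, y₂} : Finset FibAff))) (by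
        intro c hcm
        simp only [Finset.mem_insert, Finset.mem_singleton] at hcm
        rcases hcm with rfl | rfl | rfl
        · refine ⟨by rw [← mul_one (1 : FibAff)]; exact Finset.mul_mem_mul (by simp) (by simp),
            fun hm => ?_⟩
          have := (hlevs _ hm).1
          rw [one_lev] at this; omega
        · refine ⟨by rw [← one_mul c]; exact Finset.mul_mem_mul (by simp) (by simp),
            fun hm => ?_⟩
          exact (hlevs _ hm).1.false
        · exact ⟨by rw [← one_mul c]; exact Finset.mul_mem_mul (by simp) hyS, hyT⟩)
    omega

theorem lev_of_mem_mul {A B : Finset FibAff} {m n : ℤ} (hA : ∀ u ∈ A, u.lev = m)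
    (hB : ∀ u ∈ B, u.lev = n) : ∀ d ∈ A * B, d.lev = m + n := by
  intro d hd
  obtain ⟨p, hp, q, hq, rfl⟩ := Finset.mem_mul.mp hd
  rw [mul_lev, hA p hp, hB q hq]

/-- The levels 2m, m + n and 2n are distinct, so the three families are disjoint. -/
theorem card_add_card_add_card_le {X Y M S : Finset FibAff} {m n : ℤ} (hmn : m ≠ n)
    (hXl : ∀ u ∈ X, u.lev = m) (hYl : ∀ u ∈ Y, u.lev = n) (hX : X ⊆ S) (hY : Y ⊆ S)
    (hM : M ⊆ S * S) (hMl : ∀ d ∈ M, d.lev = m + n) :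
    (X * X).card + M.card + (Y * Y).card ≤ (S * S).card := by
  have hXX := lev_of_mem_mul hXl hXl
  have hYY := lev_of_mem_mul hYl hYl
  have h1 := Finset.card_add_le_of_new (A := X * X ∪ M) (B := X * X) (C := M)
    Finset.subset_union_left
    (fun c hc => ⟨Finset.mem_union_right _ hc, fun h => by
      have := hXX c h
      have := hMl c hc
      omega⟩)
  have h2 := Finset.card_add_le_of_new (A := S * S) (B := X * X ∪ M) (C := Y * Y)
    (Finset.union_subset (Finset.mul_subset_mul hX hX) hM)
    (fun c hc => ⟨Finset.mul_subset_mul hY hY hc, fun h => by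
      have h1 := hYY c hc
      rcases Finset.mem_union.mp h with h | h
      · have := hXX c h
        omega
      · have := hMl c h
        omega⟩)
  omega

/-- Off level 0 both squares have four elements, giving 4 + 3 + 4. If the second pair is in level 0
its square may have only three, but then one of the two mixed products has four. -/
theorem eleven_le_card_of_two_pairs_of_lev_ne_zero {x₁ x₂ y₁ y₂ : FibAff} (hx : x₁ < x₂)
    (hy : y₁ < y₂) (hxl : x₁.lev = x₂.lev) (hyl : y₁.lev = y₂.lev) (hxy : y₁.lev ≠ x₁.lev)
    (h0 : x₁.lev ≠ 0) {S : Finset FibAff} (hX : ({x₁, x₂} : Finset FibAff) ⊆ S)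
    (hY : ({y₁, y₂} : Finset FibAff) ⊆ S) : 11 ≤ (S * S).card := by
  have hXl : ∀ u ∈ ({x₁, x₂} : Finset FibAff), u.lev = x₁.lev := by simp [hxl]
  have hYl : ∀ u ∈ ({y₁, y₂} : Finset FibAff), u.lev = y₁.lev := by simp [hyl]
  have key := fun M => card_add_card_add_card_le (M := M) hxy.symm hXl hYl hX hY
  have hXc : ({x₁, x₂} : Finset FibAff).card = 2 := Finset.card_pair hx.ne
  have hYc : ({y₁, y₂} : Finset FibAff).card = 2 := Finset.card_pair hy.ne
  have hX4 := three_mul_card_le_card_mul_self_add_two isCommTransitive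
    (S := {x₁, x₂}) ⟨x₁, by simp, x₂, by simp, not_commute_of_lev_eq hx.ne hxl h0⟩
  have hXY := key _ (Finset.mul_subset_mul hX hY) (lev_of_mem_mul hXl hYl)
  by_cases hy0 : y₁.lev = 0
  · have hY3 := cauchy_davenport_mul_of_linearOrder_isCancelMul
      (s := ({y₁, y₂} : Finset FibAff)) (t := {y₁, y₂}) (by simp) (by simp)
    have hYX := key _ (Finset.mul_subset_mul hY hX) (fun d hd => by
      rw [lev_of_mem_mul hYl hXl d hd, add_comm])
    by_cases hXYe : x₁ * y₂ = x₂ * y₁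
    · have hYXe : y₁ * x₂ ≠ y₂ * x₁ := by
        intro h
        have h1 := congrArg val hXYe
        have h2 := congrArg val h
        simp only [mul_val, ← hxl, ← hyl, hy0, zpow_zero, one_mul] at h1 h2
        have h3 : (φ ^ x₁.lev - 1) * (y₂.val - y₁.val) = 0 := by linear_combination - h1 - h2
        have h4 := val_lt_of_lt hy hyl
        rcases mul_eq_zero.mp h3 with h5 | h5
        · exact h0 (goldenRatio_zpow_eq_one_iff.mp (by linarith))
        · linarith
      have := four_le_card_pair_mul_pair hy hx hYXe
      omega
    · have := four_le_card_pair_mul_pair hx hy hXYe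
      omega
  · have hY4 := three_mul_card_le_card_mul_self_add_two isCommTransitive
      (S := {y₁, y₂}) ⟨y₁, by simp, y₂, by simp, not_commute_of_lev_eq hy.ne hyl hy0⟩
    have := cauchy_davenport_mul_of_linearOrder_isCancelMul
      (s := ({x₁, x₂} : Finset FibAff)) (t := {y₁, y₂}) (by simp) (by simp)
    omega

/-- A noncommutative set of four elements in at least two levels. -/
theorem eleven_le_card_of_card_eq_four {S : Finset FibAff} (hS : HasNoncommPair S)
    (hc : S.card = 4) (hlev : ∀ n : ℤ, ∃ x ∈ S, x.lev ≠ n) : 11 ≤ (S * S).card := by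
  -- The identity alone on top and two elements at the bottom; the mirror case follows by applying
  -- this to `S⁻¹`.
  have hone : ∀ S : Finset FibAff, S.card = 4 → ∀ x ∈ S, x = 1 → (∀ y ∈ S, y ≠ x → y.lev < 0) →
      ∀ u ∈ S, ∀ v ∈ S, u ≠ v → u.lev = v.lev → (∀ y ∈ S, u.lev ≤ y.lev) →
      11 ≤ (S * S).card := by
    rintro S hc x hx rfl hneg u hu v hv huv hl hmin
    have hu1 : u ≠ 1 := by
      rintro rfl
      exact (hneg v hv huv.symm).ne hl.symm
    have hv1 : v ≠ 1 := by
      rintro rfl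
      exact (hneg u hu huv).ne hl
    have hcard : ({1, u, v} : Finset FibAff).card = 3 := by simp [hu1.symm, hv1.symm, huv]
    obtain ⟨w, hw, hwn⟩ := Finset.exists_mem_notMem_of_card_lt_card
      (show ({1, u, v} : Finset FibAff).card < S.card by omega)
    simp only [Finset.mem_insert, Finset.mem_singleton, not_or] at hwn
    have hSeq : {1, w, u, v} = S := by
      refine Finset.eq_of_subset_of_card_le ?_ ?_
      · simp [Finset.insert_subset_iff, hx, hw, hu, hv]
      · rw [hc]
        simp [hu1.symm, hv1.symm, huv, Ne.symm hwn.1, hwn.2.1, hwn.2.2]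
    rw [← hSeq]
    exact eleven_le_card_of_one huv hl.symm (hneg u hu hu1) (hmin w hw) (hneg w hw hwn.1)
      hwn.2.1 hwn.2.2
  obtain ⟨x, hx, -, hxm⟩ := S.exists_maximal_filter (fun _ => True)
    (by obtain ⟨y, hy⟩ := Finset.card_pos.mp (show 0 < S.card by omega); exact ⟨y, hy, trivial⟩)
  obtain ⟨w, hw, hwm⟩ := S.exists_min_image id ⟨x, hx⟩
  replace hxm : ∀ y ∈ S, y.lev ≤ x.lev := fun y hy => lev_le_of_le (hxm y hy trivial)
  replace hwm : ∀ y ∈ S, w.lev ≤ y.lev := fun y hy => lev_le_of_le (hwm y hy)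
  have hwx : w.lev < x.lev := by
    obtain ⟨y, hy, hyn⟩ := hlev x.lev
    have := hxm y hy
    have := hwm y hy
    omega
  have hcx : (S.erase x).card = 3 := by rw [Finset.card_erase_of_mem hx, hc]
  have hcw : (S.erase w).card = 3 := by rw [Finset.card_erase_of_mem hw, hc]
  -- Two elements at both extreme levels give two pairs; otherwise an extreme level has a single
  -- element, which can be deleted unless it is 1.
  by_cases hA : ∃ x' ∈ S, x' ≠ x ∧ x'.lev = x.lev
  · obtain ⟨x', hx', hxx, hx'l⟩ := hA
    by_cases hB : ∃ w' ∈ S, w' ≠ w ∧ w'.lev = w.lev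
    · obtain ⟨w', hw', hww, hw'l⟩ := hB
      obtain ⟨x₁, x₂, hx12, hxl12, hx1l, hX⟩ : ∃ x₁ x₂ : FibAff, x₁ < x₂ ∧ x₁.lev = x₂.lev ∧
          x₁.lev = x.lev ∧ ({x₁, x₂} : Finset FibAff) ⊆ S := by
        rcases lt_or_gt_of_ne hxx with h | h
        · exact ⟨x', x, h, hx'l, hx'l, by simp [Finset.insert_subset_iff, hx, hx']⟩
        · exact ⟨x, x', h, hx'l.symm, rfl, by simp [Finset.insert_subset_iff, hx, hx']⟩
      obtain ⟨w₁, w₂, hw12, hwl12, hw1l, hW⟩ : ∃ w₁ w₂ : FibAff, w₁ < w₂ ∧ w₁.lev = w₂.lev ∧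
          w₁.lev = w.lev ∧ ({w₁, w₂} : Finset FibAff) ⊆ S := by
        rcases lt_or_gt_of_ne hww with h | h
        · exact ⟨w', w, h, hw'l, hw'l, by simp [Finset.insert_subset_iff, hw, hw']⟩
        · exact ⟨w, w', h, hw'l.symm, rfl, by simp [Finset.insert_subset_iff, hw, hw']⟩
      by_cases h0 : x₁.lev = 0
      · exact eleven_le_card_of_two_pairs_of_lev_ne_zero hw12 hx12 hwl12 hxl12 (by omega)
          (by omega) hW hX
      · exact eleven_le_card_of_two_pairs_of_lev_ne_zero hx12 hw12 hxl12 hwl12 (by omega)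
          h0 hX hW
    · push Not at hB
      have hBlt : ∀ y ∈ S, y ≠ w → w.lev < y.lev := fun y hy hne =>
        lt_of_le_of_ne (hwm y hy) (hB y hy hne).symm
      by_cases hw1 : w = 1
      · have hmain := hone S⁻¹ (by simpa using hc) w⁻¹ (Finset.inv_mem_inv hw) (by simp [hw1])
          (fun y hy hne => by
            have := hBlt y⁻¹ (Finset.mem_inv'.mp hy) (fun h => hne (by rw [← h, inv_inv]))
            rw [hw1] at this
            simp only [inv_lev, one_lev] at this; omega)
          x⁻¹ (Finset.inv_mem_inv hx) x'⁻¹ (Finset.inv_mem_inv hx')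
          (fun h => hxx (inv_injective h).symm) (by simp [hx'l])
          (fun y hy => by
            have := hxm y⁻¹ (Finset.mem_inv'.mp hy)
            simp only [inv_lev] at this ⊢; omega)
        rwa [card_inv_mul_inv] at hmain
      · rw [← Finset.insert_erase hw] at hS ⊢
        exact eleven_le_card_of_lt_lev hS (fun y hy => hBlt y (Finset.mem_of_mem_erase hy)
          (Finset.ne_of_mem_erase hy)) hw1 hcw
  · push Not at hA
    have hAlt : ∀ y ∈ S, y ≠ x → y.lev < x.lev := fun y hy hne =>
      lt_of_le_of_ne (hxm y hy) (hA y hy hne)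
    by_cases hx1 : x = 1
    · by_cases hB : ∃ w' ∈ S, w' ≠ w ∧ w'.lev = w.lev
      · obtain ⟨w', hw', hww, hw'l⟩ := hB
        exact hone S hc x hx hx1 (fun y hy hne => by
          have := hAlt y hy hne
          rwa [hx1, one_lev] at this) w hw w' hw' hww.symm hw'l.symm hwm
      · push Not at hB
        have hw1 : w ≠ 1 := by rintro rfl; rw [hx1] at hwx; exact hwx.false
        rw [← Finset.insert_erase hw] at hS ⊢
        exact eleven_le_card_of_lt_lev hS (fun y hy => lt_of_le_of_ne
          (hwm y (Finset.mem_of_mem_erase hy))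
          (hB y (Finset.mem_of_mem_erase hy) (Finset.ne_of_mem_erase hy)).symm) hw1 hcw
    · rw [← Finset.insert_erase hx] at hS ⊢
      exact eleven_le_card_of_lev_lt hS (fun y hy => hAlt y (Finset.mem_of_mem_erase hy)
        (Finset.ne_of_mem_erase hy)) hx1 hcx

/-- A noncommutative set of at least four elements in at least two levels satisfies
`3 |S| ≤ |S²| + 1`. -/
theorem three_mul_card_le_card_mul_self_add_one {S : Finset FibAff} (hS : HasNoncommPair S)
    (hc : 4 ≤ S.card) (hlev : ∀ n : ℤ, ∃ x ∈ S, x.lev ≠ n) :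
    3 * S.card ≤ (S * S).card + 1 := by
  induction hc' : S.card using Nat.strong_induction_on generalizing S with
  | _ n ih =>
  subst hc'
  rcases hc.eq_or_lt with h4 | h5
  · have := eleven_le_card_of_card_eq_four hS h4.symm hlev
    omega
  have step : ∀ x T, S = insert x T → x ∉ T → HasNoncommPair T →
      (T * T).card + 3 ≤ (S * S).card → 3 * S.card ≤ (S * S).card + 1 := by
    intro x T hST hxT hT hle
    have hcT : S.card = T.card + 1 := by rw [hST, Finset.card_insert_of_notMem hxT]
    by_cases hTl : ∀ n : ℤ, ∃ y ∈ T, y.lev ≠ n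
    · have := ih T.card (by omega) hT (by omega) hTl rfl
      omega
    · push Not at hTl
      obtain ⟨n, hn⟩ := hTl
      have hxn : x.lev ≠ n := by
        obtain ⟨y, hy, hyn⟩ := hlev n
        rw [hST] at hy
        rcases Finset.mem_insert.mp hy with rfl | hy
        · exact hyn
        · exact absurd (hn y hy) hyn
      have := card_mul_self_insert_of_lev_ne hT hn hxn (by omega)
      rwa [← hST] at this
  obtain ⟨k, hk⟩ : ∃ k, S.card = k + 1 + 1 := ⟨S.card - 2, by omega⟩
  obtain ⟨x, T, hST, hxT, hTk, hx⟩ := Finset.exists_insert_max hk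
  have hmax : (HasNoncommPair T) → 3 * S.card ≤ (S * S).card + 1 := fun hT =>
    step x T hST hxT hT (by
      rw [hST]
      exact card_mul_self_erase_max_add_three_le isCommTransitive (hST ▸ hS) hx)
  by_cases hT : HasNoncommPair T
  · exact hmax hT
  -- When removing the maximum `x` leaves a commutative set, the minimum is removed instead: any `g
  -- ≠ 1` kept from `T` fails to commute with some element of `S`, which can only be `x`.
  obtain ⟨w, hw, hwm⟩ := S.exists_min_image id (Finset.card_pos.mp (by omega))
  have hmin : (T.erase w).card + 1 ≥ 4 := by
    have := Finset.pred_card_le_card_erase (s := T) (a := w)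
    omega
  obtain ⟨g, hg, hg1⟩ := Finset.exists_mem_ne (show 1 < (T.erase w).card by omega) 1
  have hgT := Finset.mem_of_mem_erase hg
  have hgw : g ∈ S.erase w := Finset.mem_erase.mpr ⟨Finset.ne_of_mem_erase hg, hST ▸ by simp [hgT]⟩
  have hSw : HasNoncommPair (S.erase w) := by
    obtain ⟨z, hz, hgz⟩ := hS.exists_of_ne_one isCommTransitive hg1
    have hzx : z = x := by
      rw [hST] at hz
      exact (Finset.mem_insert.mp hz).resolve_right fun hzT => hT ⟨g, hgT, z, hzT, hgz⟩
    have hxw : x ≠ w := by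
      rintro rfl
      exact (hx g hgT).not_ge (hwm g (hST ▸ by simp [hgT]))
    exact ⟨g, hgw, z, Finset.mem_erase.mpr ⟨hzx ▸ hxw, hz⟩, hgz⟩
  refine step w (S.erase w) (Finset.insert_erase hw).symm (Finset.notMem_erase _ _) hSw ?_
  have := card_mul_self_erase_min_add_three_le isCommTransitive (T := S.erase w) (x := w)
    (by rwa [Finset.insert_erase hw]) (fun y hy => lt_of_le_of_ne
      (hwm y (Finset.mem_of_mem_erase hy)) (Finset.ne_of_mem_erase hy).symm)
  rwa [Finset.insert_erase hw] at this

end FibAff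

/-! ### Small product sets in level one -/

theorem Finset.mem_of_isChain_of_card_le {α : Type*} [LinearOrder α] {A : Finset α} {l : List α}
    (hl : l.IsChain (· < ·)) (hA : ∀ a ∈ l, a ∈ A) (hc : A.card ≤ l.length) {a : α} (ha : a ∈ A) :
    a ∈ l := by
  have hsub : l.toFinset ⊆ A := fun a ha => hA a (List.mem_toFinset.mp ha)
  have := Finset.eq_of_subset_of_card_le hsub (by
    rwa [List.toFinset_card_of_nodup (List.isChain_iff_pairwise.mp hl).nodup])
  exact List.mem_toFinset.mp (this ▸ ha)

namespace FibAff

theorem mul_lt_mul_of_lev_eq_one {a b c d : FibAff} (ha : a.lev = 1) (hb : b.lev = 1)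
    (hc : c.lev = 1) (hd : d.lev = 1) (h : φ * a.val + b.val < φ * c.val + d.val) :
    a * b < c * d :=
  lt_iff.mpr (Or.inr ⟨by simp [ha, hb, hc, hd], by simpa [hb, hd] using h⟩)

theorem hasNoncommPair_of_lev_eq {S : Finset FibAff} {n : ℤ} (hn : n ≠ 0)
    (hS : ∀ x ∈ S, x.lev = n) (hc : 2 ≤ S.card) : HasNoncommPair S := by
  obtain ⟨x, hx, y, hy, hxy⟩ := Finset.one_lt_card.mp hc
  exact ⟨x, hx, y, hy, not_commute_of_lev_eq hxy ((hS x hx).trans (hS y hy).symm)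
    (by rw [hS x hx]; exact hn)⟩

/-- Seven products form an increasing chain, so `z * x` must be one of them. The only possibilities
are `y * y` and `y * z`, which give the two ratios. -/
theorem val_sub_of_card_le_seven {x y z : FibAff} (hx : x.lev = 1) (hy : y.lev = 1)
    (hz : z.lev = 1) (hxy : x < y) (hyz : y < z)
    (h : (({x, y, z} : Finset FibAff) * {x, y, z}).card ≤ 7) :
    z.val - x.val = φ * (y.val - x.val) ∨ z.val - x.val = (φ + 1) * (y.val - x.val) := by
  have h1 := val_lt_of_lt hxy (hx.trans hy.symm)
  have h2 := val_lt_of_lt hyz (hy.trans hz.symm)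
  have hφ := Real.one_lt_goldenRatio
  have hsq := Real.goldenRatio_sq
  have hyx : x * y < y * x := mul_lt_mul_of_lev_eq_one hx hy hy hx (by nlinarith)
  have hzy : y * z < z * y := mul_lt_mul_of_lev_eq_one hy hz hz hy (by nlinarith)
  have hmem := Finset.mem_of_isChain_of_card_le (l := [x * x, x * y, y * x, y * y, y * z, z * y,
    z * z]) (by simp [hxy, hyz, hyx, hzy]) (by simp [Finset.mul_mem_mul]) h
    (a := z * x) (Finset.mul_mem_mul (by simp) (by simp))
  simp only [List.mem_cons, List.not_mem_nil, or_false] at hmem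
  rcases hmem with h | h | h | h | h | h | h <;> replace h := congrArg val h <;>
    simp only [mul_val, hx, hy, hz, zpow_one] at h
  · nlinarith
  · nlinarith
  · nlinarith
  · left
    linear_combination (φ - 1) * h + (-z.val + y.val) * hsq
  · right
    linear_combination φ * h + (-z.val + y.val) * hsq
  · linarith
  · linarith

/-- Deleting either extreme element leaves a triple with at most seven products, so both consecutive
triples have one of the two gap ratios. -/
theorem exists_val_eq_of_card_le_ten {x y z w : FibAff} (hx : x.lev = 1) (hy : y.lev = 1)
    (hz : z.lev = 1) (hw : w.lev = 1) (hxy : x < y) (hyz : y < z) (hzw : z < w)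
    (h : (({x, y, z, w} : Finset FibAff) * {x, y, z, w}).card ≤ 10) :
    ∃ c, 0 < c ∧ y.val = x.val + c ∧ z.val = x.val + φ * c ∧ w.val = x.val + (φ + 1) * c := by
  have hNC : HasNoncommPair ({x, y, z, w} : Finset FibAff) :=
    ⟨x, by simp, y, by simp, not_commute_of_lev_eq hxy.ne (hx.trans hy.symm) (by omega)⟩
  have hperm : ({x, y, z, w} : Finset FibAff) = insert w {x, y, z} := by
    ext a; simp only [Finset.mem_insert, Finset.mem_singleton]; tauto
  have hmin := card_mul_self_erase_min_add_three_le isCommTransitive hNC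
    (by simp [hxy, hxy.trans hyz, (hxy.trans hyz).trans hzw])
  have hmax := card_mul_self_erase_max_add_three_le isCommTransitive (hperm ▸ hNC)
    (by simp [hzw, hyz.trans hzw, (hxy.trans hyz).trans hzw])
  rw [← hperm] at hmax
  have h1 := val_sub_of_card_le_seven hx hy hz hxy hyz (by omega)
  have h2 := val_sub_of_card_le_seven hy hz hw hyz hzw (by omega)
  obtain ⟨c, hc⟩ : ∃ c, c = y.val - x.val := ⟨_, rfl⟩
  have hc0 : 0 < c := by
    have := val_lt_of_lt hxy (hx.trans hy.symm); linarith
  have hyv : y.val = x.val + c := by linarith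
  have hφ := Real.one_lt_goldenRatio
  have hφ2 := Real.goldenRatio_lt_two
  have hsq := Real.goldenRatio_sq
  have hf1 : c < φ * c := by nlinarith
  have hf2 : φ * c < 2 * c := by nlinarith
  have hff : φ * (φ * c) = φ * c + c := by linear_combination c * hsq
  obtain ⟨f, hf⟩ : ∃ f, f = φ * c := ⟨_, rfl⟩
  have hfy : φ * y.val = φ * x.val + f := by rw [hyv, hf]; ring
  -- The bound φ > 3/2, needed to sort the explicit lists of products.
  have hf3 : 3 * c < 2 * (φ * c) := by nlinarith
  rw [← hf] at hf1 hf2 hf3 hff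
  have contra : ∀ l : List FibAff, l.IsChain (· < ·) → l.length = 11 →
      (∀ a ∈ l, a ∈ ({x, y, z, w} : Finset FibAff) * {x, y, z, w}) → False := by
    intro l hl hlen hA
    have := Finset.length_le_card_of_isChain l hl hA
    omega
  rw [← hc] at h1
  -- With x at 0 and c = 1, the candidates for (y, z, w) are (1, φ, 2), (1, φ, φ+1), (1, φ+1, φ+2),
  -- (1, φ+1, 2φ+2). All but the second have eleven increasing products.
  rcases h1 with h1 | h1 <;> rcases h2 with h2 | h2
  · exfalso
    have hzv : z.val = x.val + f := by linarith
    have hwv : w.val = x.val + 2 * c := by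
      rw [hzv, hyv] at h2; linarith
    have hfz : φ * z.val = φ * x.val + f + c := by rw [hzv]; linarith
    have hfw : φ * w.val = φ * x.val + 2 * f := by rw [hwv, hf]; ring
    refine contra [x * x, x * y, x * z, x * w, y * y, y * z, y * w, z * z, z * w, w * z, w * w]
      ?_ rfl (by simp [Finset.mul_mem_mul])
    simp only [List.isChain_cons_cons, List.isChain_singleton, and_true]
    refine ⟨?_, ?_, ?_, ?_, ?_, ?_, ?_, ?_, ?_, ?_⟩ <;>
      refine mul_lt_mul_of_lev_eq_one ‹_› ‹_› ‹_› ‹_› ?_ <;> linarith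
  · refine ⟨c, hc0, hyv, by linarith, ?_⟩
    have hzv : z.val = x.val + f := by linarith
    rw [hzv, hyv] at h2
    rw [add_mul, ← hf]
    linarith
  · exfalso
    have hzv : z.val = x.val + f + c := by linarith
    have hwv : w.val = x.val + f + 2 * c := by
      rw [hzv, hyv] at h2; linarith
    have hfz : φ * z.val = φ * x.val + 2 * f + c := by rw [hzv]; linarith
    have hfw : φ * w.val = φ * x.val + 3 * f + c := by rw [hwv]; linarith
    refine contra [x * x, x * y, y * x, x * z, x * w, z * x, z * y, w * x, z * z, z * w, w * w]
      ?_ rfl (by simp [Finset.mul_mem_mul])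
    simp only [List.isChain_cons_cons, List.isChain_singleton, and_true]
    refine ⟨?_, ?_, ?_, ?_, ?_, ?_, ?_, ?_, ?_, ?_⟩ <;>
      refine mul_lt_mul_of_lev_eq_one ‹_› ‹_› ‹_› ‹_› ?_ <;> linarith
  · exfalso
    have hzv : z.val = x.val + f + c := by linarith
    have hwv : w.val = x.val + 2 * f + 2 * c := by
      rw [hzv, hyv] at h2; linarith
    have hfz : φ * z.val = φ * x.val + 2 * f + c := by rw [hzv]; linarith
    have hfw : φ * w.val = φ * x.val + 4 * f + 2 * c := by rw [hwv]; linarith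
    refine contra [x * x, x * y, y * x, x * z, z * x, z * y, z * z, w * x, z * w, w * z, w * w]
      ?_ rfl (by simp [Finset.mul_mem_mul])
    simp only [List.isChain_cons_cons, List.isChain_singleton, and_true]
    refine ⟨?_, ?_, ?_, ?_, ?_, ?_, ?_, ?_, ?_, ?_⟩ <;>
      refine mul_lt_mul_of_lev_eq_one ‹_› ‹_› ‹_› ‹_› ?_ <;> linarith

/-- With at most thirteen products, the first four and the last four elements would both follow the
pattern, with steps c and d. Comparing `w` gives c = d, and comparing `z` gives φc = 2c, which
contradicts φ < 2. -/
theorem fourteen_le_card_of_lev_eq_one {x y z w v : FibAff} (hx1 : x.lev = 1) (hy1 : y.lev = 1)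
    (hz1 : z.lev = 1) (hw1 : w.lev = 1) (hv1 : v.lev = 1) (hxy : x < y) (hyz : y < z)
    (hzw : z < w) (hwv : w < v) :
    14 ≤ (({x, y, z, w, v} : Finset FibAff) * {x, y, z, w, v}).card := by
  have hNC : HasNoncommPair ({x, y, z, w, v} : Finset FibAff) :=
    ⟨x, by simp, y, by simp, not_commute_of_lev_eq hxy.ne (hx1.trans hy1.symm) (by omega)⟩
  have hperm : ({x, y, z, w, v} : Finset FibAff) = insert v {x, y, z, w} := by
    ext a; simp only [Finset.mem_insert, Finset.mem_singleton]; tauto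
  have hmin := card_mul_self_erase_min_add_three_le isCommTransitive hNC
    (by simp [hxy, hxy.trans hyz, (hxy.trans hyz).trans hzw, ((hxy.trans hyz).trans hzw).trans hwv])
  have hmax := card_mul_self_erase_max_add_three_le isCommTransitive (hperm ▸ hNC)
    (by simp [hwv, hzw.trans hwv, (hyz.trans hzw).trans hwv, ((hxy.trans hyz).trans hzw).trans hwv])
  rw [← hperm] at hmax
  by_contra! hlt
  obtain ⟨c, hc0, h1, h2, h3⟩ := exists_val_eq_of_card_le_ten hx1 hy1 hz1 hw1 hxy hyz hzw
    (by omega)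
  obtain ⟨d, hd0, h4, h5, h6⟩ := exists_val_eq_of_card_le_ten hy1 hz1 hw1 hv1 hyz hzw hwv
    (by omega)
  have h7 : φ * c = φ * d := by linarith
  have h8 : c = d := mul_left_cancel₀ Real.goldenRatio_ne_zero h7
  have hφ2 := Real.goldenRatio_lt_two
  nlinarith

/-- Five or more elements of level one. -/
theorem three_mul_card_le_of_lev_eq_one {S : Finset FibAff} (hS : ∀ x ∈ S, x.lev = 1)
    (hc : 5 ≤ S.card) : 3 * S.card ≤ (S * S).card + 1 := by
  induction hk : S.card - 5 generalizing S with
  | zero =>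
    have hS5 : S.card = 4 + 1 := by omega
    rw [hS5]
    obtain ⟨v, T, rfl, -, hT, hv⟩ := Finset.exists_insert_max hS5
    obtain ⟨w, T, rfl, -, hT, hw⟩ := Finset.exists_insert_max hT
    obtain ⟨z, T, rfl, -, hT, hz⟩ := Finset.exists_insert_max hT
    obtain ⟨y, T, rfl, -, hT, hy⟩ := Finset.exists_insert_max hT
    obtain ⟨x, rfl⟩ := Finset.card_eq_one.mp hT
    have hperm : (insert v (insert w (insert z (insert y {x}))) : Finset FibAff) =
        {x, y, z, w, v} := by
      ext a; simp only [Finset.mem_insert, Finset.mem_singleton]; tauto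
    have := fourteen_le_card_of_lev_eq_one (hS x (by simp)) (hS y (by simp)) (hS z (by simp))
      (hS w (by simp)) (hS v (by simp)) (hy x (by simp)) (hz y (by simp)) (hw z (by simp))
      (hv w (by simp))
    rw [hperm]
    omega
  | succ n ih =>
    obtain ⟨x, T, rfl, hxT, hT, hx⟩ := Finset.exists_insert_max (S := S) (n := n + 5) (by omega)
    have hNC := hasNoncommPair_of_lev_eq one_ne_zero hS (by omega)
    have := card_mul_self_erase_max_add_three_le isCommTransitive hNC hx
    have := ih (S := T) (fun y hy => hS y (by simp [hy])) (by omega) (by omega)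
    rw [Finset.card_insert_of_notMem hxT]
    omega

end FibAff

namespace FibAff

theorem isFibPair_of_val_eq {x c : FibAff} (hx : x.lev = 1) (hc : c.lev = 0) : IsFibPair x c := by
  have hsq := Real.goldenRatio_sq
  have h0 := Real.goldenRatio_ne_zero
  refine ⟨?_, ?_⟩
  · rw [rconj_sq]
    ext
    · simp [rconj, hx, hc]
    · simp only [rconj, mul_val, mul_lev, inv_lev, inv_val, hx, hc]
      generalize φ = q at *
      norm_num
      field_simp
      linear_combination c.val * hsq
  · ext
    · simp [rconj, hx, hc]
    · simp only [rconj, mul_val, mul_lev, inv_lev, inv_val, hx, hc]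
      generalize φ = q at *
      norm_num
      ring

theorem mk_zero_zpow (r : ℝ) (k : ℤ) : (⟨0, r⟩ : FibAff) ^ k = ⟨0, k * r⟩ := by
  induction k using Int.induction_on with
  | zero => ext <;> simp
  | succ n ih => rw [zpow_add_one, ih]; ext <;> simp; ring
  | pred n ih => rw [zpow_sub_one, ih]; ext <;> simp; ring

theorem mk_one_zpow (k : ℤ) : (⟨1, 0⟩ : FibAff) ^ k = ⟨k, 0⟩ := by
  induction k using Int.induction_on with
  | zero => ext <;> simp
  | succ n ih => rw [zpow_add_one, ih]; ext <;> simp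
  | pred n ih => rw [zpow_sub_one, ih]; ext <;> simp; ring

end FibAff

namespace FibGroup

/-- The embedding of `FibGroup` into `ℤ ⋉ ℝ`. -/
noncomputable def toFibAff : FibGroup →* FibAff :=
  lift (FibAff.isFibPair_of_val_eq (x := ⟨1, 0⟩) (c := ⟨0, 1⟩) rfl rfl)

theorem toFibAff_a : toFibAff a = ⟨0, 1⟩ := lift_a _

theorem toFibAff_b : toFibAff b = ⟨1, 0⟩ := lift_b _

theorem toFibAff_injective : Function.Injective toFibAff := by
  refine (injective_iff_map_eq_one toFibAff).mpr fun g hg => ?_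
  obtain ⟨u, v, k, rfl⟩ := exists_eq_ofPlane_mul_zpow g
  have hd : rconj (⟨0, 1⟩ : FibAff) ⟨1, 0⟩ = ⟨0, φ⟩ := by
    ext <;> simp [rconj]
  rw [map_mul, map_mul, map_zpow, map_zpow, map_zpow, map_rconj, toFibAff_a, toFibAff_b, hd,
    FibAff.mk_zero_zpow, FibAff.mk_zero_zpow, FibAff.mk_one_zpow] at hg
  have hk : k = 0 := by simpa using congrArg FibAff.lev hg
  subst hk
  have hval : (u : ℝ) + v * φ = 0 := by simpa using congrArg FibAff.val hg
  -- A nonzero `v` would make φ = -u/v rational.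
  have hv : v = 0 := by
    by_contra hv
    refine Real.goldenRatio_irrational ⟨-u / v, ?_⟩
    have hv' : (v : ℝ) ≠ 0 := by exact_mod_cast hv
    push_cast
    rw [div_eq_iff hv']
    linarith
  subst hv
  have hu : u = 0 := by simpa using hval
  subst hu
  simp

theorem isOrderableGroup : IsOrderableGroup FibGroup := by
  refine ⟨LinearOrder.lift' toFibAff toFibAff_injective, fun g h x y hgh => ?_⟩
  have hgh' : toFibAff g ≤ toFibAff h := hgh
  change toFibAff (x * g * y) ≤ toFibAff (x * h * y)
  simp only [map_mul]
  gcongr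

end FibGroup

/-! ### Recognising the extremal quadruple -/

namespace FibAff

theorem rconj_of_lev_eq_zero {c x : FibAff} (hc : c.lev = 0) :
    rconj c x = ⟨0, φ ^ x.lev * c.val⟩ := by
  ext
  · simp [rconj, hc]
  · have := zpow_ne_zero x.lev Real.goldenRatio_ne_zero
    simp only [rconj, mul_val, inv_val, hc, zpow_zero, one_mul, zpow_neg]
    generalize φ ^ x.lev = q at *
    field_simp
    ring

theorem exists_eq_fibQuad {P : Finset FibAff} (hP : ∀ x ∈ P, x.lev = 1) (hc : P.card = 4)
    (h : (P * P).card ≤ 10) :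
    ∃ x ∈ P, ∃ y ∈ P, x ≠ y ∧ (P : Set FibAff) = fibQuad x (x⁻¹ * y) := by
  obtain ⟨w, T, rfl, -, hT, hw⟩ := Finset.exists_insert_max hc
  obtain ⟨z, T, rfl, -, hT, hz⟩ := Finset.exists_insert_max hT
  obtain ⟨y, T, rfl, -, hT, hy⟩ := Finset.exists_insert_max hT
  obtain ⟨x, rfl⟩ := Finset.card_eq_one.mp hT
  have hperm : (insert w (insert z (insert y {x})) : Finset FibAff) = {x, y, z, w} := by
    ext a; simp only [Finset.mem_insert, Finset.mem_singleton]; tauto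
  have hx1 := hP x (by simp)
  have hy1 := hP y (by simp)
  have hz1 := hP z (by simp)
  have hw1 := hP w (by simp)
  rw [hperm] at h
  obtain ⟨c, hc0, h1, h2, h3⟩ := exists_val_eq_of_card_le_ten hx1 hy1 hz1 hw1 (hy x (by simp))
    (hz y (by simp)) (hw z (by simp)) h
  refine ⟨x, by simp, y, by simp, (hy x (by simp)).ne, ?_⟩
  have hl : (x⁻¹ * y).lev = 0 := by simp [hx1, hy1]
  have hv : (x⁻¹ * y).val = c := by
    have := Real.goldenRatio_ne_zero
    simp only [mul_val, inv_val, hx1, hy1, h1, zpow_neg, zpow_one]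
    generalize φ = q at *
    field_simp
    ring
  have hsq : φ * φ = φ + 1 := by rw [← sq, Real.goldenRatio_sq]
  have e1 : x * rconj (x⁻¹ * y) x = z := by
    rw [rconj_of_lev_eq_zero hl, hx1, hv]
    ext
    · simp [hx1, hz1]
    · simp [h2]
  have e2 : x * rconj (x⁻¹ * y) (x ^ 2) = w := by
    rw [rconj_sq, rconj_of_lev_eq_zero hl, rconj_of_lev_eq_zero rfl, hx1, hv]
    ext
    · simp [hx1, hw1]
    · simp only [mul_val, zpow_zero, one_mul, zpow_one, h3, ← mul_assoc, hsq]
  rw [fibQuad, e1, e2, mul_inv_cancel_left, hperm]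
  simp

end FibAff

/-! ### Extremal generating sets -/

namespace FibGroup

theorem exists_not_commute_of_closure_eq_top {S : Set FibGroup} (hS : Subgroup.closure S = ⊤) :
    ∃ x ∈ S, ∃ y ∈ S, ¬ Commute x y := by
  by_contra! hcon
  have h1 : Subgroup.closure S ≤ Subgroup.centralizer S :=
    (Subgroup.closure_le _).mpr fun x hx => Subgroup.mem_centralizer_iff.mpr fun y hy =>
      (hcon y hy x hx).eq
  have h2 : Subgroup.closure S ≤ Subgroup.center FibGroup :=
    (Subgroup.closure_le _).mpr fun x hx => Subgroup.mem_center_iff.mpr fun g => by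
      have hg : g ∈ Subgroup.centralizer S := h1 (hS ▸ Subgroup.mem_top g)
      exact (Subgroup.mem_centralizer_iff.mp hg x hx).symm
  have h3 := Subgroup.mem_center_iff.mp (h2 (hS ▸ Subgroup.mem_top a)) b
  have h4 := congrArg (fun g => (toFibAff g).val) h3
  simp only [map_mul, toFibAff_a, toFibAff_b, FibAff.mul_val] at h4
  have := Real.one_lt_goldenRatio
  simp only [zpow_zero, zpow_one] at h4
  linarith

/-- The level is a homomorphism to ℤ, so `n` divides the level of every element, in particular that
of `b`, which is 1. -/
theorem lev_eq_one_or_neg_one {S : Set FibGroup} (hS : Subgroup.closure S = ⊤) {n : ℤ}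
    (hn : ∀ x ∈ S, (toFibAff x).lev = n) : n = 1 ∨ n = -1 := by
  have h : ∀ g ∈ Subgroup.closure S, n ∣ (toFibAff g).lev := by
    intro g hg
    induction hg using Subgroup.closure_induction with
    | mem x hx => rw [hn x hx]
    | one => simp
    | mul x y _ _ hx hy => rw [map_mul, FibAff.mul_lev]; exact dvd_add hx hy
    | inv x _ hx => rw [map_inv, FibAff.inv_lev]; exact hx.neg_right
  have h1 := h b (hS ▸ Subgroup.mem_top b)
  rw [toFibAff_b] at h1
  exact Int.isUnit_iff.mp (isUnit_of_dvd_one h1)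

theorem exists_finset_image {S : Set FibGroup} (hfin : S.Finite) :
    ∃ P : Finset FibAff, (P : Set FibAff) = toFibAff '' S ∧ P.card = S.ncard ∧
      (P * P).card = (S * S).ncard := by
  refine ⟨(hfin.image toFibAff).toFinset, by simp, ?_, ?_⟩
  · rw [← Set.ncard_coe_finset, Set.Finite.coe_toFinset,
      Set.ncard_image_of_injective _ toFibAff_injective]
  · rw [← Set.ncard_coe_finset, Finset.coe_mul, Set.Finite.coe_toFinset, ← Set.image_mul,
      Set.ncard_image_of_injective _ toFibAff_injective]

theorem ncard_inv_mul_inv (S : Set FibGroup) : (S⁻¹ * S⁻¹).ncard = (S * S).ncard := by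
  rw [← mul_inv_rev, ← Set.image_inv_eq_inv, Set.ncard_image_of_injective _ inv_injective]

theorem ncard_inv (S : Set FibGroup) : S⁻¹.ncard = S.ncard := by
  rw [← Set.image_inv_eq_inv, Set.ncard_image_of_injective _ inv_injective]

/-- A generating set of at least four elements with `|S²| = 3 |S| - 2` lies in level `1` or
level `-1`. -/
theorem lev_eq_of_ncard {S : Set FibGroup} (hfin : S.Finite) (hS : Subgroup.closure S = ⊤)
    (h : (S * S).ncard + 2 = 3 * S.ncard) (h4 : 4 ≤ S.ncard) :
    (∀ x ∈ S, (toFibAff x).lev = 1) ∨ ∀ x ∈ S⁻¹, (toFibAff x).lev = 1 := by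
  obtain ⟨P, hP, hc, hcc⟩ := exists_finset_image hfin
  have hmem : ∀ x ∈ S, toFibAff x ∈ P := fun x hx => by
    rw [← Finset.mem_coe, hP]; exact Set.mem_image_of_mem _ hx
  have hNC : HasNoncommPair P := by
    obtain ⟨x, hx, y, hy, hxy⟩ := exists_not_commute_of_closure_eq_top hS
    refine ⟨_, hmem x hx, _, hmem y hy, fun hcom => hxy (toFibAff_injective ?_)⟩
    rw [map_mul, map_mul]; exact hcom
  obtain ⟨n, hn⟩ : ∃ n : ℤ, ∀ x ∈ S, (toFibAff x).lev = n := by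
    by_contra! hcon
    have := FibAff.three_mul_card_le_card_mul_self_add_one hNC (by omega) fun n => by
      obtain ⟨x, hx, hxn⟩ := hcon n
      exact ⟨_, hmem x hx, hxn⟩
    omega
  rcases lev_eq_one_or_neg_one hS hn with rfl | rfl
  · exact Or.inl hn
  · refine Or.inr fun x hx => ?_
    have := hn x⁻¹ hx
    rw [map_inv, FibAff.inv_lev] at this
    omega

theorem ncard_le_four_of_lev {S : Set FibGroup} (hfin : S.Finite)
    (h : (S * S).ncard + 2 = 3 * S.ncard) (hl : ∀ x ∈ S, (toFibAff x).lev = 1) :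
    S.ncard ≤ 4 := by
  obtain ⟨P, hP, hc, hcc⟩ := exists_finset_image hfin
  by_contra! hlt
  have := FibAff.three_mul_card_le_of_lev_eq_one (S := P) (fun x hx => by
    rw [← Finset.mem_coe, hP] at hx
    obtain ⟨g, hg, rfl⟩ := hx
    exact hl g hg) (by omega)
  omega

theorem exists_fibQuad_of_lev {S : Set FibGroup} (hfin : S.Finite)
    (h : (S * S).ncard + 2 = 3 * S.ncard) (h4 : S.ncard = 4)
    (hl : ∀ x ∈ S, (toFibAff x).lev = 1) :
    ∃ x c : FibGroup, c ≠ 1 ∧ IsFibPair x c ∧ S = fibQuad x c := by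
  obtain ⟨P, hP, hc, hcc⟩ := exists_finset_image hfin
  have hPl : ∀ x ∈ P, x.lev = 1 := fun x hx => by
    rw [← Finset.mem_coe, hP] at hx
    obtain ⟨g, hg, rfl⟩ := hx
    exact hl g hg
  obtain ⟨x', hx, y', hy, hxy, hPeq⟩ := FibAff.exists_eq_fibQuad hPl (by omega) (by omega)
  rw [← Finset.mem_coe, hP] at hx hy
  obtain ⟨x, hx, rfl⟩ := hx
  obtain ⟨y, hy, rfl⟩ := hy
  refine ⟨x, x⁻¹ * y, fun h1 => hxy ?_, ?_, ?_⟩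
  · rw [inv_mul_eq_one.mp h1]
  · have hp := FibAff.isFibPair_of_val_eq (x := toFibAff x) (c := toFibAff (x⁻¹ * y))
      (hl x hx) (by simp [hl x hx, hl y hy])
    exact ⟨toFibAff_injective (by simpa only [map_mul, map_rconj, map_pow] using hp.1),
      toFibAff_injective (by simpa only [map_mul, map_rconj] using hp.2)⟩
  · apply Set.image_injective.mpr toFibAff_injective
    rw [← hP, hPeq]
    simp [fibQuad, Set.image_insert_eq, map_rconj]

/-- Either sign of `c` may be chosen in the description of a set as `fibQuad x c`. -/
theorem exists_fibQuad_of_order (o : LinearOrder FibGroup) (ho : IsGroupOrder o) {S : Set FibGroup}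
    (h : ∃ x c : FibGroup, c ≠ 1 ∧ IsFibPair x c ∧ S = fibQuad x c) :
    (∃ x c : FibGroup, o.lt 1 c ∧ IsFibPair x c ∧ S = fibQuad x c) ∧
      ∃ x c : FibGroup, o.lt c 1 ∧ IsFibPair x c ∧ S = fibQuad x c := by
  obtain ⟨x, c, hc, hxc, rfl⟩ := h
  let _ := o
  have hinv : ∀ g k : FibGroup, g ≤ k → k⁻¹ ≤ g⁻¹ := fun g k hgk => by
    have := ho g k g⁻¹ k⁻¹ hgk
    simpa using this
  obtain ⟨hr1, hr2⟩ := hxc.reverse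
  rcases lt_or_gt_of_ne hc with hlt | hlt
  · refine ⟨⟨_, c⁻¹, ?_, hr1, hr2.symm⟩, ⟨x, c, hlt, hxc, rfl⟩⟩
    refine lt_of_le_of_ne ?_ (inv_ne_one.mpr hc).symm
    simpa using hinv c 1 hlt.le
  · refine ⟨⟨x, c, hlt, hxc, rfl⟩, ⟨_, c⁻¹, ?_, hr1, hr2.symm⟩⟩
    refine lt_of_le_of_ne ?_ (by simpa using hc)
    simpa using hinv 1 c hlt.le

end FibGroup

theorem theorem2 :
    -- the group is `ℤ² ⋊ ℤ` with the Fibonacci matrix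
    (∃ e : FibGroup ≃* (Multiplicative (ℤ × ℤ)) ⋊[fibAction] (Multiplicative ℤ),
      e (PresentedGroup.of 0) = SemidirectProduct.inl (Multiplicative.ofAdd ((1, 0) : ℤ × ℤ)) ∧
      e (PresentedGroup.of 1) = SemidirectProduct.inr (Multiplicative.ofAdd (1 : ℤ))) ∧
    IsOrderableGroup FibGroup ∧
    (∀ S : Set FibGroup, S.Finite → Subgroup.closure S = ⊤ →
      (S * S).ncard + 2 = 3 * S.ncard → S.ncard ≤ 4) ∧
    (∀ o : LinearOrder FibGroup, IsGroupOrder o →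
      ∀ S : Set FibGroup, S.Finite → Subgroup.closure S = ⊤ →
      (S * S).ncard + 2 = 3 * S.ncard → S.ncard = 4 →
      ∃ x c : FibGroup, o.lt 1 c ∧
        rconj c (x ^ 2) = c * rconj c x ∧ c * rconj c x = rconj c x * c ∧
        (S = {x, x * c, x * rconj c x, x * rconj c (x ^ 2)} ∨
         S = {x⁻¹, x⁻¹ * c, x⁻¹ * rconj c x, x⁻¹ * rconj c (x ^ 2)})) := by
  refine ⟨⟨FibGroup.equivSemidirect, FibGroup.lift_a FibGroup.isFibPair_semidirect,
      FibGroup.lift_b FibGroup.isFibPair_semidirect⟩,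
    FibGroup.isOrderableGroup, ?_, ?_⟩
  · intro S hfin hS h
    by_contra! hlt
    rcases FibGroup.lev_eq_of_ncard hfin hS h hlt.le with hl | hl
    · have := FibGroup.ncard_le_four_of_lev hfin h hl
      omega
    · have := FibGroup.ncard_le_four_of_lev hfin.inv
        (by rwa [FibGroup.ncard_inv_mul_inv, FibGroup.ncard_inv]) hl
      rw [FibGroup.ncard_inv] at this
      omega
  · intro o ho S hfin hS h h4
    rcases FibGroup.lev_eq_of_ncard hfin hS h h4.ge with hl | hl
    · obtain ⟨⟨x, c, hc, hxc, hSeq⟩, -⟩ := FibGroup.exists_fibQuad_of_order o ho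
        (FibGroup.exists_fibQuad_of_lev hfin h h4 hl)
      exact ⟨x, c, hc, hxc.1, hxc.2, Or.inl hSeq⟩
    -- In level -1 the pattern is found for `S⁻¹` with `c` negative, since passing back to `S`
    -- replaces `c` by `x * c⁻¹ * x⁻¹`, which is then positive.
    · obtain ⟨-, x, c, hc, hxc, hSeq⟩ := FibGroup.exists_fibQuad_of_order o ho
        (FibGroup.exists_fibQuad_of_lev hfin.inv
          (by rwa [FibGroup.ncard_inv_mul_inv, FibGroup.ncard_inv])
          (by rwa [FibGroup.ncard_inv]) hl)
      obtain ⟨h1, h2, h3⟩ := hxc.inv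
      refine ⟨x, x * c⁻¹ * x⁻¹, ?_, h1, h2, Or.inr ?_⟩
      · let _ := o
        have hle := ho c 1 (x * c⁻¹) x⁻¹ hc.le
        refine lt_of_le_of_ne (by simpa using hle) fun he => hc.ne ?_
        have := mul_inv_eq_one.mp he.symm
        simpa using this
      · rw [← h3, ← hSeq, inv_inv]
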